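/- Let $\mathcal H_1,\mathcal H_2$ be separable real Hilbert spaces, let $S^\dagger:\mathcal H_1\to\mathcal H_2$ be a bounded linear operator, and let $y=S^\dagger x+\epsilon$, where $x$ is a random element of $\mathcal H_1$ with $\mathbb E\|x\|^2\le 1$ and $\epsilon$ is a random element of $\mathcal H_2$, independent of $x$, with $\mathbb E\,\epsilon=0$ and $\mathbb E\|\epsilon\|^2<\infty$. For $f\in\mathcal H_i$, $e\in\mathcal H_1$ write $f\otimes e:=\langle e,\cdot\rangle f$. Let $L_C=\mathbb E[x\otimes x]$ be the covariance operator of $x$, and let $\mathcal E(S)=\mathbb E\|y-Sx\|^2$ for bounded linear $S:\mathcal H_1\to\mathcal H_2$. Assume: - (weak regularity) $S^\dagger=JL_C^{r}$ for some bounded linear operator $J:\mathcal H_1\to\mathcal H_2$ and some $r>0$; - (spectral decay) $\mathrm{Tr}(L_C^{s})<\infty$ for some $0<s\le 1$; - (moment condition) $c>0$ is a constant such that, for $i=1,2$ and every compact linear operator $A:\mathcal H_1\to\mathcal H_i$, $\mathbb E\|Ax\|^4\le c\,(\mathbb E\|Ax\|^2)^2$. For $T\ge 1$ let $z_1=(x_1,y_1),\dots,z_T=(x_T,y_T)$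 be independent copies of $(x,y)$, and let $S_1=0$, $S_{t+1}=S_t-\eta_t\,(S_tx_t-y_t)\otimes x_t$ for $1\le t\le T$, with step sizes $\eta_t=\eta_1t^{-\theta}$, where $\eta_1>0$. For $0<\theta<1$ let $C(\eta_1,1,\theta)$ be the least constant $C$ such that for all integers $T\ge 2$ $$\sum_{t=1}^{T-1}\frac{\eta_t^2}{1+\sum_{j=t+1}^{T}\eta_j}\le C\cdot\begin{cases}(T+1)^{-\theta}\log(T+1),&0<\theta\le\frac12,\\(T+1)^{-(1-\theta)},&\frac12<\theta<1.\end{cases}$$ With $\theta$ as in (1) or (2) below, assume that $\eta_1$ is so small that $$c\left[3\,C(\eta_1,1,\theta)\max\Big\{\frac1{e\theta},1\Big\}+\eta_1^2\right]<1\qquad\text{and}\qquad \eta_1\|L_C\|<1 .$$ Then $\mathcal E(S_{T+1})-\mathcal E(S^\dagger)$ is integrable for every $T\ge1$, and the following holds. (1) If $s=1$ and $\theta=\min\{\frac{2r}{2r+1},\frac12\}$, then there is a constant $c_r$, independent of $T$, such that for all $T\ge1$ $$\mathbb E\big[\mathcal E(S_{T+1})-\mathcal E(S^\dagger)\big]\le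 c_r\,(T+1)^{-\theta}\log(T+1).$$ (2) If $0<s<1$ and $$\theta=\min\Big\{\frac{2r+1-s}{2r+2-s},\frac{2-s}{3-s}\Big\}=\begin{cases}\frac{2r+1-s}{2r+2-s},&r<\frac12,\\ \frac{2-s}{3-s},&r\ge\frac12,\end{cases}$$ then there is a constant $c_{r,s}$, independent of $T$, such that for all $T\ge1$ $$\mathbb E\big[\mathcal E(S_{T+1})-\mathcal E(S^\dagger)\big]\le c_{r,s}\,(T+1)^{-\theta}.$$ -/

import Mathlib

open MeasureTheory ProbabilityTheory
open scoped ENNReal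

noncomputable section

namespace OperatorSGD

variable {H : Type*} [NormedAddCommGroup H] [InnerProductSpace ℝ H] [CompleteSpace H]
variable {H₁ : Type*} [NormedAddCommGroup H₁] [InnerProductSpace ℝ H₁] [CompleteSpace H₁]
variable {H₂ : Type*} [NormedAddCommGroup H₂] [InnerProductSpace ℝ H₂] [CompleteSpace H₂]

/-- The eigenspaces of a bounded operator are closed, hence complete. -/
instance completeSpace_eigenspace (L : H →L[ℝ] H) (a : ℝ) :
    CompleteSpace (Module.End.eigenspace (L : Module.End ℝ H) a) := by
  have h : IsClosed ((Module.End.eigenspace (L : Module.End ℝ H) a : Submodule ℝ H) : Set H) := by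
    have h' : ((Module.End.eigenspace (L : Module.End ℝ H) a : Submodule ℝ H) : Set H)
        = {v | L v = a • v} := by
      ext v
      simp
    rw [h']
    exact isClosed_eq L.continuous (continuous_const_smul a)
  exact h.completeSpace_coe

/-- The power `L ^ α`, `α > 0`, of a compact self-adjoint nonnegative operator `L`, by its spectral
decomposition: `L ^ α = ∑ a, a ^ α • P a`, where `P a` is the orthogonal projection onto the
eigenspace of `L` for `a` (which is `0` unless `a` is an eigenvalue). For such `L` and `α` the
series converges in operator norm. -/
def opPow (L : H →L[ℝ] H) (α : ℝ) : H →L[ℝ] H :=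
  ∑' a : ℝ, a ^ α • (Module.End.eigenspace (L : Module.End ℝ H) a).starProjection

/-- The trace `∑ k, ⟪A e k, e k⟫` of a self-adjoint nonnegative operator `A`, as an element of
`[0, ∞]`; the orthonormal basis `e` (the value does not depend on it) is any one that
`exists_hilbertBasis` provides. -/
def opTrace (A : H →L[ℝ] H) : ℝ≥0∞ :=
  ∑' k : (exists_hilbertBasis ℝ H).choose,
    ENNReal.ofReal (inner ℝ (A (k : H)) (k : H))

/-- The covariance operator `L_C = 𝔼[x ⊗ x]`, where `(f ⊗ e) v = ⟪e, v⟫ • f`. -/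
def covOp {Ω : Type*} [MeasurableSpace Ω] (μ : Measure Ω) (x : Ω → H) : H →L[ℝ] H :=
  ∫ ω, InnerProductSpace.rankOne ℝ (x ω) (x ω) ∂μ

/-- The risk `ℰ(S) = 𝔼 ‖y - S x‖ ^ 2`. -/
def risk {Ω : Type*} [MeasurableSpace Ω] (μ : Measure Ω) (x : Ω → H₁) (y : Ω → H₂)
    (S : H₁ →L[ℝ] H₂) : ℝ :=
  ∫ ω, ‖y ω - S (x ω)‖ ^ 2 ∂μ

/-- The moment inequality with constant `c` for compact operators from `H₁` to `H`:
`𝔼 ‖A x‖ ^ 4 ≤ c (𝔼 ‖A x‖ ^ 2) ^ 2` for every compact `A`. -/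
def MomentCondition {Ω : Type*} [MeasurableSpace Ω] (μ : Measure Ω) (x : Ω → H₁)
    (H : Type*) [NormedAddCommGroup H] [InnerProductSpace ℝ H] (c : ℝ) : Prop :=
  ∀ A : H₁ →L[ℝ] H, IsCompactOperator A →
    ∫⁻ ω, ‖A (x ω)‖ₑ ^ 4 ∂μ ≤ ENNReal.ofReal c * (∫⁻ ω, ‖A (x ω)‖ₑ ^ 2 ∂μ) ^ 2

/-- Stochastic gradient descent with step sizes `η 1, η 2, …` along the data
`z 1, z 2, …`, where `z t = (x_t, y_t)`: `sgd η z t` is the iterate `S_{t+1}` obtained from the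
first `t` data points, so `S_1 = 0` and `S_{t+1} = S_t - η_t • (S_t x_t - y_t) ⊗ x_t`. -/
def sgd (η : ℕ → ℝ) (z : ℕ → H₁ × H₂) : ℕ → (H₁ →L[ℝ] H₂)
  | 0 => 0
  | t + 1 => sgd η z t - η (t + 1) •
      InnerProductSpace.rankOne ℝ (sgd η z t (z (t + 1)).1 - (z (t + 1)).2) (z (t + 1)).1

/-- The polynomially decaying step sizes `η_t = η₁ t ^ (-θ)`. -/
def polyStep (η₁ θ : ℝ) (t : ℕ) : ℝ := η₁ * (t : ℝ) ^ (-θ)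

/-- `z 1, …, z T` are independent copies of the pair `(x, y)`. -/
structure IsIIDSample {Ω : Type*} [MeasurableSpace Ω] (μ : Measure Ω)
    {E : Type*} [MeasurableSpace E] (p : Ω → E)
    {Ω' : Type*} [MeasurableSpace Ω'] (P : Measure Ω') (T : ℕ) (z : ℕ → Ω' → E) : Prop where
  indep : iIndepFun (fun t : Finset.Icc 1 T => z t) P
  ident : ∀ t ∈ Finset.Icc 1 T, IdentDistrib (z t) p P μ

/-- The sum `∑_{t=1}^{T-1} η_t ^ 2 / (1 + ∑_{j=t+1}^{T} η_j)` for `η_t = η₁ t ^ (-θ)`. -/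
def stepSum (η₁ θ : ℝ) (T : ℕ) : ℝ :=
  ∑ t ∈ Finset.Icc 1 (T - 1),
    polyStep η₁ θ t ^ 2 / (1 + ∑ j ∈ Finset.Icc (t + 1) T, polyStep η₁ θ j)

/-- The rate `(T+1) ^ (-θ) log (T+1)` if `θ ≤ 1/2`, and `(T+1) ^ (-(1-θ))` if `θ > 1/2`. -/
def stepRate (θ : ℝ) (T : ℕ) : ℝ :=
  if θ ≤ 1 / 2 then ((T : ℝ) + 1) ^ (-θ) * Real.log ((T : ℝ) + 1) else ((T : ℝ) + 1) ^ (-(1 - θ))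

/-- The constant `C(η₁, 1, θ)`: the least `C` such that
`∑_{t=1}^{T-1} η_t ^ 2 / (1 + ∑_{j=t+1}^{T} η_j) ≤ C * stepRate θ T` for all `T ≥ 2`. (For
`η₁ > 0` and `0 < θ < 1` such `C` exist, and they are all positive.) -/
def stepConst (η₁ θ : ℝ) : ℝ :=
  sInf {C : ℝ | ∀ T : ℕ, 2 ≤ T → stepSum η₁ θ T ≤ C * stepRate θ T}

/-- The smallness condition `c (3 C(η₁, 1, θ) max {1 / (e θ), 1} + η₁ ^ 2) < 1`. -/
def StepCondition (c η₁ θ : ℝ) : Prop :=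
  c * (3 * stepConst η₁ θ * max (1 / (Real.exp 1 * θ)) 1 + η₁ ^ 2) < 1

end OperatorSGD

end

/-!
The error `D_t = S_t - S†` of stochastic gradient descent satisfies
`D_{t+1} = D_t - η_t (D_t x_t - ε_t) ⊗ x_t`, and the excess risk of an operator with error `D` is the
second moment `Φ(D) = 𝔼 ‖D x‖ ^ 2` (`sqMoment`, `risk_sub_risk`), a squared Hilbert seminorm on
operators: `Φ(D) = ‖D L ^ (1/2)‖ ^ 2` in the Hilbert-Schmidt norm, `L` being the covariance operator.

Fix a deterministic operator `R` and look at `Φ(D_{t+1} R)`. In the mean over the new data point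
`D_{t+1}` is `D_t (1 - η_t L)`, and a random vector exceeds its mean by at most its second moment, so
`𝔼 Φ(D_{t+1} R) ≤ 𝔼 Φ(D_t (1 - η_t L) R) + η_t ^ 2 N`. The noise `N` is the mean of
`‖D_t x - ε‖ ^ 2 ‖L ^ (1/2) R† x‖ ^ 2`, and the Cauchy-Schwarz inequality with the moment condition
bounds it by `((1 + δ) c Φ(D_t) + (1 + 1/δ) 𝔼 ‖ε‖ ^ 2) Φ(L ^ (1/2) R†)` for every `δ > 0`
(`lintegral_sqMoment_step_le`; the `D_t` are compact because `S† = J L ^ r` is). Starting from `R = 1`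
and going backwards through the steps, `R` runs through the residual polynomials
`Q_t = ∏_{j > t} (1 - η_j L)`, which gives the bias-variance decomposition
`meanErr_le_bias_add_variance`.

In an eigenbasis of `L` every operator involved is diagonal (`IsDiag`), so bias and variance are sums
over the eigenvalues `λ`. With `σ_t = ∑_{j > t} η_j` one has `Q_t(λ) ^ 2 ≤ exp (-2 λ σ_t)`, hence
`λ ^ p Q_t(λ) ^ 2 ≤ K (1 + σ_t) ^ (-p)`, and `Tr(L ^ s) < ∞` yields
`Φ(L ^ (1/2) Q_t) = Tr(L ^ 2 Q_t ^ 2) ≤ K (1 + σ_t) ^ (-(2 - s))` for the variance and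
`Φ(S† Q_0) ≤ K (1 + σ_0) ^ (-(2 r + 1 - s))` for the bias (`tsum_rpow_mul_prod_sq_le`,
`exists_bias_le`).

The case `s = 1` of the variance bound shows that the total weight of the noise is at most
`3 C(η₁, 1, θ) max {1 / (e θ), 1} + η₁ ^ 2`. The smallness condition thus makes the recursion for the
mean errors contractive, and they stay bounded (`exists_meanErr_le_bias_add`). With bounded noise the
rate is that of `∑ η_t ^ 2 / (1 + σ_t) ^ (2 - s)`: for `s = 1` the sum defining `C(η₁, 1, θ)`, and
for `s < 1` a sum of order `T ^ (-θ)` as long as `θ ≤ (1 - θ) (2 - s)`, by splitting it at `T / 2`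
(`exists_sum_polyStep_sq_div_rpow_le`). The exponent `θ` of the theorem is the one that satisfies this
and `θ ≤ (1 - θ) (2 r + 1 - s)`, the condition coming from the bias.
-/

namespace OperatorSGD

universe u

/-! ### Operators that are diagonal in a Hilbert basis -/

section diagonal

variable {H : Type*} [NormedAddCommGroup H] [InnerProductSpace ℝ H]

lemma eq_of_inner_basis {ι : Type*} {b : HilbertBasis ι ℝ H} {u v : H}
    (h : ∀ i, inner ℝ (b i) u = inner ℝ (b i) v) : u = v := by
  apply b.repr.injective
  ext i
  simp only [b.repr_apply_apply, h]

/-- `A` acts on the Hilbert basis `b` as the diagonal matrix with real entries `a`. The condition is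
put on the coordinates of `A v` instead of the vectors `A (b i)`, which makes it stable under
composition without any symmetry assumption. -/
def IsDiag {ι : Type*} (b : HilbertBasis ι ℝ H) (A : H →L[ℝ] H) (a : ι → ℝ) : Prop :=
  ∀ i v, inner ℝ (b i) (A v) = a i * inner ℝ (b i) v

namespace IsDiag

variable {ι : Type*} {b : HilbertBasis ι ℝ H} {A B : H →L[ℝ] H} {a a' : ι → ℝ}

lemma one : IsDiag b (1 : H →L[ℝ] H) 1 := fun i v => by simp

lemma comp (hA : IsDiag b A a) (hB : IsDiag b B a') : IsDiag b (A ∘L B) (fun i => a i * a' i) := by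
  intro i v
  rw [ContinuousLinearMap.comp_apply, hA, hB, mul_assoc]

lemma add (hA : IsDiag b A a) (hB : IsDiag b B a') : IsDiag b (A + B) (fun i => a i + a' i) := by
  intro i v
  simp only [add_apply, inner_add_right, hA i v, hB i v, add_mul]

lemma smul (c : ℝ) (hA : IsDiag b A a) : IsDiag b (c • A) (fun i => c * a i) := by
  intro i v
  simp only [smul_apply, inner_smul_right, hA i v, mul_assoc]

lemma aeval (hA : IsDiag b A a) (p : Polynomial ℝ) :
    IsDiag b (Polynomial.aeval A p) (fun i => p.eval (a i)) := by
  induction p using Polynomial.induction_on' with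
  | add p q hp hq => simpa using hp.add hq
  | monomial n c =>
    have hpow : IsDiag b (A ^ n) (fun i => a i ^ n) := by
      induction n with
      | zero => simpa using! (one : IsDiag b 1 1)
      | succ n ih =>
        have := ih.comp hA
        simp only [← pow_succ] at this
        exact this
    simpa [Polynomial.aeval_monomial, Algebra.smul_def] using hpow.smul c

lemma apply_basis (hA : IsDiag b A a) (i : ι) : A (b i) = a i • b i := by
  apply eq_of_inner_basis (b := b)
  intro j
  rw [hA, inner_smul_right]
  rcases eq_or_ne j i with rfl | h
  · rfl
  · simp [b.orthonormal.2 h]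

lemma of_apply_basis [CompleteSpace H] (hs : IsSelfAdjoint A) (h : ∀ i, A (b i) = a i • b i) :
    IsDiag b A a := by
  intro i v
  rw [← ContinuousLinearMap.adjoint_inner_left, hs.adjoint_eq, h, real_inner_smul_left]

lemma ext (hA : IsDiag b A a) (hB : IsDiag b B a) : A = B := by
  ext v
  exact eq_of_inner_basis fun i => by rw [hA, hB]

lemma adjoint_eq [CompleteSpace H] (hA : IsDiag b A a) : ContinuousLinearMap.adjoint A = A := by
  refine ext (a := a) (fun i v => ?_) hA
  rw [ContinuousLinearMap.adjoint_inner_right, hA.apply_basis, real_inner_smul_left]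

lemma hasSum_inner (hA : IsDiag b A a) (v : H) :
    HasSum (fun i => a i * inner ℝ (b i) v ^ 2) (inner ℝ (A v) v) := by
  refine (b.hasSum_inner_mul_inner (A v) v).congr_fun ?_
  intro i
  rw [real_inner_comm (b i), hA, sq, mul_assoc]

lemma hasSum_norm_sq (hA : IsDiag b A a) (v : H) :
    HasSum (fun i => a i ^ 2 * inner ℝ (b i) v ^ 2) (‖A v‖ ^ 2) := by
  rw [← real_inner_self_eq_norm_sq]
  refine (b.hasSum_inner_mul_inner (A v) (A v)).congr_fun ?_
  intro i
  rw [real_inner_comm (b i), hA]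
  ring

lemma enorm_sq (hA : IsDiag b A a) (v : H) :
    ‖A v‖ₑ ^ 2 = ∑' i, ENNReal.ofReal (a i ^ 2 * inner ℝ (b i) v ^ 2) := by
  have h := hA.hasSum_norm_sq v
  rw [← ENNReal.ofReal_tsum_of_nonneg (fun i => by positivity) h.summable, h.tsum_eq,
    ENNReal.ofReal_pow (norm_nonneg _), ofReal_norm]

lemma norm_le (hA : IsDiag b A a) {C : ℝ} (hC : 0 ≤ C) (h : ∀ i, |a i| ≤ C) : ‖A‖ ≤ C := by
  refine ContinuousLinearMap.opNorm_le_bound _ hC fun v => ?_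
  refine le_of_sq_le_sq ?_ (by positivity)
  rw [mul_pow]
  have h1 : HasSum (fun i => C ^ 2 * inner ℝ (b i) v ^ 2) (C ^ 2 * ‖v‖ ^ 2) := by
    simpa using (one (b := b)).hasSum_norm_sq v |>.mul_left (C ^ 2)
  refine hasSum_le (fun i => ?_) (hA.hasSum_norm_sq v) h1
  have : a i ^ 2 ≤ C ^ 2 := sq_le_sq' (by linarith [abs_le.1 (h i)]) (abs_le.1 (h i)).2
  gcongr

end IsDiag

/-! ### Powers and traces in an eigenbasis -/

variable [CompleteSpace H]

/-- Orthonormal bases of the members of an orthogonal family with dense span add up to one of the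
whole space. -/
lemma exists_hilbertBasis_mem {κ : Type*} (V : κ → Submodule ℝ H) [∀ a, CompleteSpace (V a)]
    (hV : OrthogonalFamily ℝ (fun a => V a) fun a => (V a).subtypeₗᵢ) (hbot : (⨆ a, V a)ᗮ = ⊥) :
    ∃ (w : ∀ a, Set (V a)) (b : HilbertBasis (Σ a, w a) ℝ H), ∀ k, b k ∈ V k.1 := by
  choose w e he using fun a => exists_hilbertBasis ℝ (V a)
  have hon := hV.orthonormal_sigma_orthonormal (fun a => (e a).orthonormal)
  have hspan : (Submodule.span ℝ (Set.range fun k : Σ a, w a =>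
      (V k.1).subtypeₗᵢ (e k.1 k.2)))ᗮ = ⊥ := by
    rw [eq_bot_iff, ← hbot]
    intro v hv
    rw [← Submodule.iInf_orthogonal, Submodule.mem_iInf]
    intro a
    rw [← Submodule.starProjection_apply_eq_zero_iff, Submodule.starProjection_apply]
    have h0 : (V a).orthogonalProjectionOnto v = 0 := by
      apply eq_of_inner_basis (b := e a)
      intro i
      rw [inner_zero_right, Submodule.inner_orthogonalProjectionOnto_eq_of_mem_left]
      exact (Submodule.mem_orthogonal _ _).1 hv _ (Submodule.subset_span ⟨⟨a, i⟩, rfl⟩)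
    rw [h0, Submodule.coe_zero]
  refine ⟨w, HilbertBasis.mkOfOrthogonalEqBot hon hspan, fun k => ?_⟩
  rw [HilbertBasis.coe_mkOfOrthogonalEqBot]
  exact (e k.1 k.2).2

lemma exists_hilbertBasis_isDiag {H : Type u} [NormedAddCommGroup H] [InnerProductSpace ℝ H]
    [CompleteSpace H] {L : H →L[ℝ] H} (hc : IsCompactOperator L) (hs : IsSelfAdjoint L) :
    ∃ (ι : Type u) (b : HilbertBasis ι ℝ H) (l : ι → ℝ), IsDiag b L l := by
  obtain ⟨w, b, hb⟩ := exists_hilbertBasis_mem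
    (fun a : ℝ => Module.End.eigenspace (L : Module.End ℝ H) a)
    hs.isSymmetric.orthogonalFamily_eigenspaces
    (ContinuousLinearMap.orthogonalComplement_iSup_eigenspaces_eq_bot hc hs.isSymmetric)
  exact ⟨_, b, fun k => k.1, IsDiag.of_apply_basis hs fun k => Module.End.mem_eigenspace_iff.1 (hb k)⟩

section opPow

variable {ι : Type*} {b : HilbertBasis ι ℝ H} {L : H →L[ℝ] H} {l : ι → ℝ}

open Classical in
lemma IsDiag.starProjection_eigenspace (hL : IsDiag b L l) (a : ℝ) :
    IsDiag b (Module.End.eigenspace (L : Module.End ℝ H) a).starProjection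
      (fun i => if l i = a then 1 else 0) := by
  refine IsDiag.of_apply_basis ?_ fun i => ?_
  · exact isSelfAdjoint_starProjection _
  split_ifs with h
  · rw [one_smul, Submodule.starProjection_eq_self_iff, Module.End.mem_eigenspace_iff, ← h]
    exact hL.apply_basis i
  · rw [zero_smul, Submodule.starProjection_apply_eq_zero_iff, Submodule.mem_orthogonal']
    intro v hv
    have h1 := hL i v
    rw [show L v = a • v from Module.End.mem_eigenspace_iff.1 hv, inner_smul_right] at h1
    have : (l i - a) * inner ℝ (b i) v = 0 := by linarith
    exact (mul_eq_zero.1 this).resolve_left (sub_ne_zero.2 h)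

open Classical in
/-- The spectral series defining `opPow` converges in operator norm: only finitely many eigenvalues
exceed a given threshold, and a partial sum avoiding them is diagonal with small entries. -/
lemma IsDiag.summable_opPow (hL : IsDiag b L l) (hl : ∀ i, 0 ≤ l i) (hsum : Summable l)
    {α : ℝ} (hα : 0 < α) :
    Summable fun a : ℝ =>
      a ^ α • (Module.End.eigenspace (L : Module.End ℝ H) a).starProjection := by
  rw [summable_iff_vanishing_norm]
  intro δ hδ
  have hfin : {i | (δ / 2) ^ (1 / α) ≤ l i}.Finite := by
    have := hsum.tendsto_cofinite_zero.eventually (gt_mem_nhds (show 0 < (δ / 2) ^ (1 / α) by positivity))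
    simpa [Filter.eventually_cofinite] using this
  refine ⟨(hfin.image l).toFinset, fun t ht => ?_⟩
  have hdiag : IsDiag b (∑ a ∈ t, a ^ α •
      (Module.End.eigenspace (L : Module.End ℝ H) a).starProjection)
      (fun i => if l i ∈ t then l i ^ α else 0) := by
    intro i v
    rw [sum_apply, inner_sum]
    simp only [((hL.starProjection_eigenspace _).smul _) i v]
    rw [← Finset.sum_mul]
    congr 1
    simp
  refine lt_of_le_of_lt (hdiag.norm_le (C := δ / 2) (by positivity) fun i => ?_) (by linarith)
  split_ifs with h
  · rw [abs_of_nonneg (Real.rpow_nonneg (hl i) _)]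
    have hi : l i < (δ / 2) ^ (1 / α) := by
      by_contra! hcon
      exact Finset.disjoint_left.1 ht h (hfin.image l |>.mem_toFinset.2 ⟨i, hcon, rfl⟩)
    calc l i ^ α ≤ ((δ / 2) ^ (1 / α)) ^ α := Real.rpow_le_rpow (hl i) hi.le hα.le
      _ = δ / 2 := by
        rw [← Real.rpow_mul (by positivity), one_div_mul_cancel hα.ne', Real.rpow_one]
  · simp; positivity

lemma IsDiag.opPow (hL : IsDiag b L l) (hl : ∀ i, 0 ≤ l i) (hsum : Summable l)
    {α : ℝ} (hα : 0 < α) : IsDiag b (opPow L α) (fun i => l i ^ α) := by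
  classical
  intro i v
  have h1 := (hL.summable_opPow hl hsum hα).hasSum
  have h2 := (h1.mapL (ContinuousLinearMap.apply ℝ H v)).mapL (innerSL ℝ (b i))
  have h3 : HasSum (fun a : ℝ => if a = l i then l i ^ α * inner ℝ (b i) v else 0)
      (inner ℝ (b i) (OperatorSGD.opPow L α v)) := by
    refine h2.congr_fun fun a => ?_
    have := ((hL.starProjection_eigenspace a).smul (a ^ α)) i v
    simp only [ContinuousLinearMap.apply_apply, innerSL_apply_apply]
    rw [this]
    by_cases h : a = l i
    · simp [h]
    · simp [h, Ne.symm h]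
  exact h3.unique (hasSum_ite_eq (l i) _)

lemma IsDiag.isCompactOperator_opPow (hL : IsDiag b L l) (hc : IsCompactOperator L)
    (hl : ∀ i, 0 ≤ l i) (hsum : Summable l) {α : ℝ} (hα : 0 < α) :
    IsCompactOperator (OperatorSGD.opPow L α) := by
  refine isCompactOperator_of_tendsto (hL.summable_opPow hl hsum hα).hasSum
    (Filter.Eventually.of_forall fun t => ?_)
  have : ∑ a ∈ t, a ^ α • (Module.End.eigenspace (L : Module.End ℝ H) a).starProjection
      ∈ compactOperator (RingHom.id ℝ) H H := by
    refine Submodule.sum_mem _ fun a _ => ?_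
    rcases eq_or_ne a 0 with rfl | ha
    · rw [Real.zero_rpow hα.ne', zero_smul]
      exact Submodule.zero_mem _
    · refine Submodule.smul_mem _ _ ?_
      -- on the eigenspace of `a ≠ 0` the identity is `a⁻¹ • L`
      have h : (Module.End.eigenspace (L : Module.End ℝ H) a).starProjection
          = a⁻¹ • (L ∘L (Module.End.eigenspace (L : Module.End ℝ H) a).starProjection) := by
        ext v
        have : L ((Module.End.eigenspace (L : Module.End ℝ H) a).starProjection v)
            = a • (Module.End.eigenspace (L : Module.End ℝ H) a).starProjection v :=
          Module.End.mem_eigenspace_iff.1 (Submodule.starProjection_apply_mem _ v)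
        simp [this, smul_smul, ha]
      rw [h]
      exact Submodule.smul_mem _ _ (hc.comp_clm _)
  exact this

/-- The trace does not depend on the orthonormal basis; here, against a basis diagonalizing `A`. -/
lemma IsDiag.opTrace_eq {A : H →L[ℝ] H} {a : ι → ℝ} (hA : IsDiag b A a) (ha : ∀ i, 0 ≤ a i) :
    opTrace A = ∑' i, ENNReal.ofReal (a i) := by
  unfold opTrace
  obtain ⟨e, he⟩ := (exists_hilbertBasis ℝ H).choose_spec
  have h1 : ∀ k : (exists_hilbertBasis ℝ H).choose,
      ENNReal.ofReal (inner ℝ (A (k : H)) (k : H))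
        = ∑' i, ENNReal.ofReal (a i * inner ℝ (b i) (k : H) ^ 2) := by
    intro k
    have h := hA.hasSum_inner (k : H)
    rw [← h.tsum_eq, ENNReal.ofReal_tsum_of_nonneg _ h.summable]
    exact fun i => mul_nonneg (ha i) (sq_nonneg _)
  simp_rw [h1]
  rw [ENNReal.tsum_comm]
  refine tsum_congr fun i => ?_
  have h2 := (IsDiag.one (b := e)).enorm_sq (b i)
  simp_rw [ENNReal.ofReal_mul (ha i)]
  rw [ENNReal.tsum_mul_left]
  have h3 : ‖(b i)‖ₑ = 1 := by
    rw [← ofReal_norm, b.orthonormal.1 i, ENNReal.ofReal_one]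
  simp only [one_apply_eq_self, h3, he, Pi.one_apply, one_pow, one_mul] at h2
  simp_rw [real_inner_comm (b i)] at h2
  rw [← h2, mul_one]

end opPow

end diagonal

/-! ### The covariance operator -/

section covariance

lemma countable_of_hilbertBasis {H : Type*} [NormedAddCommGroup H] [InnerProductSpace ℝ H]
    [TopologicalSpace.SeparableSpace H] {ι : Type*} (b : HilbertBasis ι ℝ H) : Countable ι := by
  refine Pairwise.countable_of_isOpen_disjoint (s := fun i => Metric.ball (b i) (1 / 2))
    (fun i j hij => ?_) (fun _ => Metric.isOpen_ball)
    (fun i => ⟨b i, Metric.mem_ball_self (by norm_num)⟩)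
  refine Metric.ball_disjoint_ball ?_
  have h : ‖b i - b j‖ ^ 2 = 2 := by
    rw [norm_sub_sq_real, b.orthonormal.1, b.orthonormal.1, b.orthonormal.2 hij]
    norm_num
  rw [dist_eq_norm]
  nlinarith [norm_nonneg (b i - b j)]

lemma isCompactOperator_rankOne {H₁ H₂ : Type*} [NormedAddCommGroup H₁] [InnerProductSpace ℝ H₁]
    [NormedAddCommGroup H₂] [InnerProductSpace ℝ H₂] (u : H₂) (v : H₁) :
    IsCompactOperator (InnerProductSpace.rankOne ℝ u v) := by
  rw [InnerProductSpace.rankOne_def']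
  have h : IsCompactOperator (innerSL ℝ v) := isCompactOperator_of_locallyCompactSpace_dom _
  exact h.clm_comp (ContinuousLinearMap.toSpanSingleton ℝ u)

lemma continuous_rankOne {H₁ H₂ : Type*} [NormedAddCommGroup H₁] [InnerProductSpace ℝ H₁]
    [NormedAddCommGroup H₂] [InnerProductSpace ℝ H₂] :
    Continuous fun p : H₂ × H₁ => InnerProductSpace.rankOne ℝ p.1 p.2 := by
  have h : Continuous fun p : H₂ × H₁ =>
      ContinuousLinearMap.smulRightL ℝ H₁ H₂ (innerSL ℝ p.2) p.1 :=
    ((ContinuousLinearMap.smulRightL ℝ H₁ H₂).continuous.comp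
      ((innerSL ℝ).continuous.comp continuous_snd)).clm_apply continuous_fst
  exact h

variable {Ω : Type*} [MeasurableSpace Ω] {μ : Measure Ω}

/-- The second moment `𝔼 ‖A x‖ ^ 2`, the square of the Hilbert-Schmidt norm of `A L ^ (1/2)` for the
covariance operator `L` of `x`. -/
noncomputable def sqMoment {H₁ H₂ : Type*} [NormedAddCommGroup H₁] [NormedSpace ℝ H₁] [NormedAddCommGroup H₂]
    [NormedSpace ℝ H₂] (μ : Measure Ω) (x : Ω → H₁) (A : H₁ →L[ℝ] H₂) : ℝ≥0∞ :=
  ∫⁻ ω, ‖A (x ω)‖ₑ ^ 2 ∂μ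

variable {H : Type*} [NormedAddCommGroup H] [InnerProductSpace ℝ H] {x : Ω → H}

lemma integrable_rankOne_of_memLp {H₂ : Type*} [NormedAddCommGroup H₂] [InnerProductSpace ℝ H₂]
    {y : Ω → H₂} (hx : MemLp x 2 μ) (hy : MemLp y 2 μ) :
    Integrable (fun ω => InnerProductSpace.rankOne ℝ (y ω) (x ω)) μ := by
  have hm : AEStronglyMeasurable (fun ω => InnerProductSpace.rankOne ℝ (y ω) (x ω)) μ :=
    Continuous.comp_aestronglyMeasurable (g := fun p : H₂ × H => InnerProductSpace.rankOne ℝ p.1 p.2)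
      (f := fun ω => (y ω, x ω)) continuous_rankOne (hy.1.prodMk hx.1)
  have h : Integrable (fun ω => ‖y ω‖ * ‖x ω‖) μ := hy.norm.integrable_mul hx.norm
  have hn : ∀ ω, ‖InnerProductSpace.rankOne ℝ (y ω) (x ω)‖ ≤ ‖y ω‖ * ‖x ω‖ := fun ω =>
    (InnerProductSpace.norm_rankOne _ _).le
  exact h.mono' hm (Filter.Eventually.of_forall hn)

variable [CompleteSpace H]

lemma inner_covOp (hx : MemLp x 2 μ) (u v : H) :
    inner ℝ u (covOp μ x v) = ∫ ω, inner ℝ u (x ω) * inner ℝ v (x ω) ∂μ := by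
  unfold covOp
  have h := integrable_rankOne_of_memLp hx hx
  rw [ContinuousLinearMap.integral_apply h, ← integral_inner (h.apply_continuousLinearMap v)]
  refine integral_congr_ae (Filter.Eventually.of_forall fun ω => ?_)
  simp only [InnerProductSpace.rankOne_apply, inner_smul_right]
  rw [real_inner_comm v, mul_comm]

lemma isSelfAdjoint_covOp (hx : MemLp x 2 μ) : IsSelfAdjoint (covOp μ x) := by
  rw [ContinuousLinearMap.isSelfAdjoint_iff_isSymmetric]
  intro u v
  simp only [ContinuousLinearMap.coe_coe]
  rw [real_inner_comm, inner_covOp hx, inner_covOp hx]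
  simp_rw [mul_comm]

lemma isCompactOperator_covOp [IsProbabilityMeasure μ] (hx : MemLp x 2 μ) :
    IsCompactOperator (covOp μ x) := by
  have h : covOp μ x ∈ {A : H →L[ℝ] H | IsCompactOperator A} :=
    Convex.integral_mem (compactOperator (RingHom.id ℝ) H H).convex
      isClosed_setOfPred_isCompactOperator
      (Filter.Eventually.of_forall fun ω => isCompactOperator_rankOne (x ω) (x ω))
      (integrable_rankOne_of_memLp hx hx)
  exact h

section eigenbasis

variable {ι : Type*} {b : HilbertBasis ι ℝ H} {l : ι → ℝ}

lemma integral_inner_basis_sq (hx : MemLp x 2 μ) (hL : IsDiag b (covOp μ x) l) (i : ι) :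
    ∫ ω, inner ℝ (b i) (x ω) ^ 2 ∂μ = l i := by
  have h := inner_covOp hx (b i) (b i)
  rw [hL.apply_basis, inner_smul_right, real_inner_self_eq_norm_sq, b.orthonormal.1] at h
  simp_rw [← sq] at h
  simpa using h.symm

lemma eigenvalue_nonneg (hx : MemLp x 2 μ) (hL : IsDiag b (covOp μ x) l) (i : ι) : 0 ≤ l i := by
  rw [← integral_inner_basis_sq hx hL]
  exact integral_nonneg fun ω => sq_nonneg _

lemma IsDiag.sqMoment_eq [TopologicalSpace.SeparableSpace H] (hx : MemLp x 2 μ)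
    (hL : IsDiag b (covOp μ x) l) {A : H →L[ℝ] H} {a : ι → ℝ} (hA : IsDiag b A a) :
    sqMoment μ x A = ∑' i, ENNReal.ofReal (a i ^ 2 * l i) := by
  have := countable_of_hilbertBasis b
  unfold sqMoment
  simp_rw [hA.enorm_sq]
  have hm : ∀ i, AEStronglyMeasurable (fun ω => inner ℝ (b i) (x ω)) μ := fun i =>
    aestronglyMeasurable_const.inner hx.1
  have hm' : ∀ i, AEMeasurable
      (fun ω => ENNReal.ofReal (a i ^ 2 * inner ℝ (b i) (x ω) ^ 2)) μ := fun i =>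
    (((hm i).pow 2).const_mul (a i ^ 2)).aemeasurable.ennreal_ofReal
  rw [lintegral_tsum hm']
  refine tsum_congr fun i => ?_
  have hi : Integrable (fun ω => inner ℝ (b i) (x ω) ^ 2) μ := by
    have : MemLp (fun ω => inner ℝ (b i) (x ω)) 2 μ := hx.const_inner (b i)
    exact this.integrable_sq
  rw [← ofReal_integral_eq_lintegral_ofReal (hi.const_mul _)
    (Filter.Eventually.of_forall fun ω => by positivity), integral_const_mul,
    integral_inner_basis_sq hx hL]

end eigenbasis

end covariance

/-! ### One step of the recursion, for a fixed current iterate -/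

section step

section generalities

variable {Ω : Type*} [MeasurableSpace Ω] {μ : Measure Ω}

lemma ofReal_integral_norm_sq {V : Type*} [NormedAddCommGroup V] {G : Ω → V} (hG : MemLp G 2 μ) :
    ENNReal.ofReal (∫ ω, ‖G ω‖ ^ 2 ∂μ) = ∫⁻ ω, ‖G ω‖ₑ ^ 2 ∂μ := by
  rw [ofReal_integral_eq_lintegral_ofReal (hG.integrable_norm_pow two_ne_zero)
    (Filter.Eventually.of_forall fun ω => by positivity)]
  simp_rw [ENNReal.ofReal_pow (norm_nonneg _), ofReal_norm]

lemma enorm_toLp_sq {V : Type*} [NormedAddCommGroup V] {G : Ω → V} (hG : MemLp G 2 μ) :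
    ‖hG.toLp G‖ₑ ^ 2 = ∫⁻ ω, ‖G ω‖ₑ ^ 2 ∂μ := by
  rw [Lp.enorm_toLp, eLpNorm_eq_lintegral_rpow_enorm_toReal two_ne_zero ENNReal.ofNat_ne_top]
  simp only [ENNReal.toReal_ofNat, ENNReal.rpow_ofNat]
  rw [← ENNReal.rpow_natCast, ← ENNReal.rpow_mul]
  norm_num

lemma memLp_two_of_lintegral_ne_top {V : Type*} [NormedAddCommGroup V] {G : Ω → V}
    (hm : AEStronglyMeasurable G μ) (h : ∫⁻ ω, ‖G ω‖ₑ ^ 2 ∂μ ≠ ∞) : MemLp G 2 μ := by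
  refine ⟨hm, ?_⟩
  rw [eLpNorm_lt_top_iff_lintegral_rpow_enorm_lt_top two_ne_zero ENNReal.ofNat_ne_top]
  simpa [lt_top_iff_ne_top] using h

/-- The bias-variance inequality in a Hilbert space: a random vector `G` may be replaced by its mean
at the cost of its second moment. -/
lemma lintegral_enorm_sub_smul_sq_le {V : Type*} [NormedAddCommGroup V] [InnerProductSpace ℝ V]
    [CompleteSpace V] [IsProbabilityMeasure μ] {G : Ω → V} (hG : MemLp G 2 μ) (h : V) (η : ℝ) :
    ∫⁻ ω, ‖h - η • G ω‖ₑ ^ 2 ∂μ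
      ≤ ‖h - η • ∫ ω, G ω ∂μ‖ₑ ^ 2 + ENNReal.ofReal (η ^ 2) * ∫⁻ ω, ‖G ω‖ₑ ^ 2 ∂μ := by
  have hI : Integrable G μ := hG.integrable one_le_two
  have hsq : Integrable (fun ω => ‖G ω‖ ^ 2) μ := hG.integrable_norm_pow two_ne_zero
  have hin : Integrable (fun ω => inner ℝ h (G ω)) μ := hI.const_inner h
  have hd : MemLp (fun ω => h - η • G ω) 2 μ := (memLp_const h).sub (hG.const_smul η)
  rw [← ofReal_integral_norm_sq hd, ← ofReal_integral_norm_sq hG, ← ofReal_norm,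
    ← ENNReal.ofReal_pow (norm_nonneg _), ← ENNReal.ofReal_mul (sq_nonneg _),
    ← ENNReal.ofReal_add (by positivity)
      (mul_nonneg (sq_nonneg _) (integral_nonneg fun ω => by positivity))]
  refine ENNReal.ofReal_le_ofReal ?_
  have h1 : ∀ ω, ‖h - η • G ω‖ ^ 2
      = ‖h‖ ^ 2 - 2 * η * inner ℝ h (G ω) + η ^ 2 * ‖G ω‖ ^ 2 := by
    intro ω
    rw [norm_sub_sq_real, inner_smul_right, norm_smul, mul_pow, Real.norm_eq_abs, sq_abs]
    ring
  simp_rw [h1]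
  have hi1 : Integrable (fun ω => ‖h‖ ^ 2 - 2 * η * inner ℝ h (G ω)) μ :=
    (integrable_const _).sub (hin.const_mul _)
  rw [integral_add hi1 (hsq.const_mul _),
    integral_sub (integrable_const _) (hin.const_mul _), integral_const_mul, integral_const_mul,
    integral_inner hI, integral_const, probReal_univ, one_smul, norm_sub_sq_real, inner_smul_right]
  nlinarith [sq_nonneg ‖η • ∫ ω, G ω ∂μ‖]

/-- Cauchy-Schwarz, for two squares with fourth moments controlled by the second ones. -/
lemma lintegral_mul_sq_le_of_fourth_moment {f g : Ω → ℝ≥0∞} (hf : AEMeasurable f μ)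
    (hg : AEMeasurable g μ) {c : ℝ≥0∞}
    (hf4 : ∫⁻ ω, f ω ^ 4 ∂μ ≤ c * (∫⁻ ω, f ω ^ 2 ∂μ) ^ 2)
    (hg4 : ∫⁻ ω, g ω ^ 4 ∂μ ≤ c * (∫⁻ ω, g ω ^ 2 ∂μ) ^ 2) :
    ∫⁻ ω, f ω ^ 2 * g ω ^ 2 ∂μ ≤ c * (∫⁻ ω, f ω ^ 2 ∂μ) * ∫⁻ ω, g ω ^ 2 ∂μ := by
  have h := ENNReal.lintegral_mul_le_Lp_mul_Lq μ Real.HolderConjugate.two_two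
    (hf.pow_const 2) (hg.pow_const 2)
  simp only [Pi.mul_apply, ENNReal.rpow_ofNat, ← pow_mul] at h
  refine h.trans ?_
  calc (∫⁻ ω, f ω ^ (2 * 2) ∂μ) ^ (1 / (2 : ℝ)) * (∫⁻ ω, g ω ^ (2 * 2) ∂μ) ^ (1 / (2 : ℝ))
      ≤ (c * (∫⁻ ω, f ω ^ 2 ∂μ) ^ 2) ^ (1 / (2 : ℝ))
        * (c * (∫⁻ ω, g ω ^ 2 ∂μ) ^ 2) ^ (1 / (2 : ℝ)) := by gcongr
    _ = ((c * (∫⁻ ω, f ω ^ 2 ∂μ) * ∫⁻ ω, g ω ^ 2 ∂μ) ^ 2) ^ (1 / (2 : ℝ)) := by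
      rw [← ENNReal.mul_rpow_of_nonneg _ _ (by norm_num)]
      ring_nf
    _ = _ := by
      rw [← ENNReal.rpow_natCast, ← ENNReal.rpow_mul]
      norm_num

lemma enorm_sub_sq_le {V : Type*} [NormedAddCommGroup V] (u v : V) {δ : ℝ} (hδ : 0 < δ) :
    ‖u - v‖ₑ ^ 2 ≤ ENNReal.ofReal (1 + δ) * ‖u‖ₑ ^ 2 + ENNReal.ofReal (1 + δ⁻¹) * ‖v‖ₑ ^ 2 := by
  simp_rw [← ofReal_norm]
  rw [← ENNReal.ofReal_pow (norm_nonneg _), ← ENNReal.ofReal_pow (norm_nonneg _),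
    ← ENNReal.ofReal_pow (norm_nonneg _), ← ENNReal.ofReal_mul (by positivity),
    ← ENNReal.ofReal_mul (by positivity), ← ENNReal.ofReal_add (by positivity) (by positivity)]
  refine ENNReal.ofReal_le_ofReal ?_
  have h1 : ‖u - v‖ ^ 2 ≤ (‖u‖ + ‖v‖) ^ 2 := by
    gcongr
    exact norm_sub_le u v
  have h2 : 2 * (‖u‖ * ‖v‖) ≤ δ * ‖u‖ ^ 2 + δ⁻¹ * ‖v‖ ^ 2 := by
    have : 0 ≤ δ⁻¹ * (δ * ‖u‖ - ‖v‖) ^ 2 := by positivity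
    have h3 : δ⁻¹ * (δ * ‖u‖ - ‖v‖) ^ 2
        = δ * ‖u‖ ^ 2 + δ⁻¹ * ‖v‖ ^ 2 - 2 * (‖u‖ * ‖v‖) := by
      field_simp
      ring
    linarith
  linarith

end generalities

variable {H₁ : Type*} [NormedAddCommGroup H₁] [InnerProductSpace ℝ H₁]
variable {H₂ : Type*} [NormedAddCommGroup H₂] [InnerProductSpace ℝ H₂]
variable {Ω : Type*} [MeasurableSpace Ω] {μ : Measure Ω} {x : Ω → H₁} {ε : Ω → H₂}

/-- Composition with `x`, as a bounded map from operators to square integrable functions; `sqMoment`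
is its squared norm. -/
noncomputable def compLp (hx : MemLp x 2 μ) : (H₁ →L[ℝ] H₂) →L[ℝ] Lp H₂ 2 μ :=
  ((ContinuousLinearMap.id ℝ (H₁ →L[ℝ] H₂)).compLpL₂ 2 μ).flip (hx.toLp x)

lemma enorm_compLp_sq (hx : MemLp x 2 μ) (A : H₁ →L[ℝ] H₂) :
    ‖compLp hx A‖ₑ ^ 2 = sqMoment μ x A := by
  have h : compLp hx A = (A.comp_memLp' hx).toLp (A ∘ x) := by
    ext1
    filter_upwards [A.coeFn_compLp (hx.toLp x), hx.coeFn_toLp, (A.comp_memLp' hx).coeFn_toLp]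
      with ω h0 h1 h2
    rw [h2, Function.comp, ← h1, ← h0]
    rfl
  rw [h, enorm_toLp_sq]
  rfl

lemma continuous_sqMoment (hx : MemLp x 2 μ) :
    Continuous fun A : H₁ →L[ℝ] H₂ => sqMoment μ x A := by
  simp_rw [← enorm_compLp_sq hx]
  exact (ENNReal.continuous_pow 2).comp ((compLp hx).continuous.enorm)

lemma sqMoment_ne_top (hx : MemLp x 2 μ) (A : H₁ →L[ℝ] H₂) : sqMoment μ x A ≠ ∞ := by
  rw [← enorm_compLp_sq hx]
  exact ENNReal.pow_ne_top enorm_ne_top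

lemma sqMoment_comp_le {H₃ : Type*} [NormedAddCommGroup H₃] [InnerProductSpace ℝ H₃]
    (J : H₂ →L[ℝ] H₃) (A : H₁ →L[ℝ] H₂) :
    sqMoment μ x (J ∘L A) ≤ ‖J‖ₑ ^ 2 * sqMoment μ x A := by
  unfold sqMoment
  rw [← lintegral_const_mul' _ _ (ENNReal.pow_ne_top enorm_ne_top)]
  refine lintegral_mono fun ω => ?_
  rw [← mul_pow]
  gcongr
  exact J.le_opENorm _

variable [CompleteSpace H₁] [CompleteSpace H₂]

/-- The noise `ε ⊗ x` has mean zero. -/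
lemma integral_rankOne_eq_zero [MeasurableSpace H₁] [BorelSpace H₁] [MeasurableSpace H₂]
    [BorelSpace H₂] (hx : Integrable x μ) (hε : Integrable ε μ) (hε0 : ∫ ω, ε ω ∂μ = 0)
    (hind : IndepFun x ε μ) : ∫ ω, InnerProductSpace.rankOne ℝ (ε ω) (x ω) ∂μ = 0 := by
  have h := hind.integral_bilin hx hε
    ((ContinuousLinearMap.smulRightL ℝ H₁ H₂) ∘L
      (innerSL ℝ : H₁ →L[ℝ] H₁ →L[ℝ] ℝ))
  rw [hε0, map_zero] at h
  exact h

/-- One step of the recursion from a fixed iterate with error `D`, tested against a fixed operator `R`: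
in the mean the error is multiplied by `1 - η L`, and the fluctuation is controlled by the fourth
moments. The parameter `δ` balances the two parts `D x` and `ε` of the residual. -/
lemma lintegral_sqMoment_step_le [IsProbabilityMeasure μ] [MeasurableSpace H₁] [BorelSpace H₁]
    [MeasurableSpace H₂] [BorelSpace H₂]
    (hx : MemLp x 2 μ) (hε : MemLp ε 2 μ) (hε0 : ∫ ω, ε ω ∂μ = 0) (hind : IndepFun x ε μ)
    {c : ℝ} (hm1 : MomentCondition μ x H₁ c) (hm2 : MomentCondition μ x H₂ c)
    {D : H₁ →L[ℝ] H₂} (hD : IsCompactOperator D) (R : H₁ →L[ℝ] H₁)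
    {A : H₁ →L[ℝ] H₁} (hA : IsCompactOperator A)
    (hAR : ∀ u, ∫⁻ ω, ‖inner ℝ u (R (x ω))‖ₑ ^ 2 ∂μ = ‖A u‖ₑ ^ 2)
    (η : ℝ) {δ : ℝ} (hδ : 0 < δ) :
    ∫⁻ ω, sqMoment μ x
        ((D - η • InnerProductSpace.rankOne ℝ (D (x ω) - ε ω) (x ω)) ∘L R) ∂μ
      ≤ sqMoment μ x (D ∘L ((1 - η • covOp μ x) ∘L R))
        + ENNReal.ofReal (η ^ 2) *
          ((ENNReal.ofReal (1 + δ) * ENNReal.ofReal c * sqMoment μ x D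
            + ENNReal.ofReal (1 + δ⁻¹) * ∫⁻ ω, ‖ε ω‖ₑ ^ 2 ∂μ) * sqMoment μ x A) := by
  set W : Ω → H₁ →L[ℝ] H₂ := fun ω => InnerProductSpace.rankOne ℝ (D (x ω) - ε ω) (x ω) with hW
  have hDx : MemLp (fun ω => D (x ω)) 2 μ := D.comp_memLp' hx
  have hAx : MemLp (fun ω => A (x ω)) 2 μ := A.comp_memLp' hx
  have hWi : Integrable W μ := integrable_rankOne_of_memLp hx (hDx.sub hε)
  have hWm : ∫ ω, W ω ∂μ = D ∘L covOp μ x := by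
    have h1 : ∀ ω, W ω = ContinuousLinearMap.compL ℝ H₁ H₁ H₂ D
        (InnerProductSpace.rankOne ℝ (x ω) (x ω)) - InnerProductSpace.rankOne ℝ (ε ω) (x ω) := by
      intro ω
      simp only [hW, map_sub, sub_apply, ContinuousLinearMap.compL_apply,
        InnerProductSpace.comp_rankOne]
    have hxx := integrable_rankOne_of_memLp hx hx
    simp_rw [h1]
    rw [integral_sub (ContinuousLinearMap.integrable_comp _ hxx)
      (integrable_rankOne_of_memLp hx hε), ContinuousLinearMap.integral_comp_comm _ hxx,
      integral_rankOne_eq_zero (hx.integrable one_le_two) (hε.integrable one_le_two) hε0 hind,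
      sub_zero]
    rfl
  -- `Θ` embeds operators, composed with `R`, into square integrable functions
  set Θ : (H₁ →L[ℝ] H₂) →L[ℝ] Lp H₂ 2 μ :=
    compLp hx ∘L (ContinuousLinearMap.compL ℝ H₁ H₁ H₂).flip R with hΘ
  have hΘsq : ∀ B, ‖Θ B‖ₑ ^ 2 = sqMoment μ x (B ∘L R) := fun B => enorm_compLp_sq hx _
  have hWsq : ∀ ω, ‖Θ (W ω)‖ₑ ^ 2 = ‖D (x ω) - ε ω‖ₑ ^ 2 * ‖A (x ω)‖ₑ ^ 2 := by
    intro ω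
    rw [hΘsq, ← hAR, sqMoment, ← lintegral_const_mul' _ _ (ENNReal.pow_ne_top enorm_ne_top)]
    refine lintegral_congr fun ω' => ?_
    simp only [hW, ContinuousLinearMap.comp_apply, InnerProductSpace.rankOne_apply, enorm_smul]
    ring
  have hnoise : ∫⁻ ω, ‖Θ (W ω)‖ₑ ^ 2 ∂μ
      ≤ (ENNReal.ofReal (1 + δ) * ENNReal.ofReal c * sqMoment μ x D
            + ENNReal.ofReal (1 + δ⁻¹) * ∫⁻ ω, ‖ε ω‖ₑ ^ 2 ∂μ) * sqMoment μ x A := by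
    have hmD : AEMeasurable (fun ω => ‖D (x ω)‖ₑ) μ := hDx.1.enorm
    have hmA : AEMeasurable (fun ω => ‖A (x ω)‖ₑ) μ := hAx.1.enorm
    have hmε : AEMeasurable (fun ω => ‖ε ω‖ₑ) μ := hε.1.enorm
    have h1 : ∫⁻ ω, ‖D (x ω)‖ₑ ^ 2 * ‖A (x ω)‖ₑ ^ 2 ∂μ
        ≤ ENNReal.ofReal c * sqMoment μ x D * sqMoment μ x A :=
      lintegral_mul_sq_le_of_fourth_moment hmD hmA (hm2 D hD) (hm1 A hA)
    have h2 : ∫⁻ ω, ‖ε ω‖ₑ ^ 2 * ‖A (x ω)‖ₑ ^ 2 ∂μ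
        = (∫⁻ ω, ‖ε ω‖ₑ ^ 2 ∂μ) * sqMoment μ x A := by
      have hi : IndepFun (fun ω => ‖ε ω‖ₑ ^ 2) (fun ω => ‖A (x ω)‖ₑ ^ 2) μ :=
        hind.symm.comp (φ := fun e : H₂ => ‖e‖ₑ ^ 2) (ψ := fun u : H₁ => ‖A u‖ₑ ^ 2)
          (by fun_prop) (by fun_prop)
      exact lintegral_mul_eq_lintegral_mul_lintegral_of_indepFun' (hmε.pow_const 2)
        (hmA.pow_const 2) hi
    calc ∫⁻ ω, ‖Θ (W ω)‖ₑ ^ 2 ∂μ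
        ≤ ∫⁻ ω, (ENNReal.ofReal (1 + δ) * (‖D (x ω)‖ₑ ^ 2 * ‖A (x ω)‖ₑ ^ 2)
            + ENNReal.ofReal (1 + δ⁻¹) * (‖ε ω‖ₑ ^ 2 * ‖A (x ω)‖ₑ ^ 2)) ∂μ := by
          refine lintegral_mono fun ω => ?_
          simp only [hWsq]
          rw [← mul_assoc, ← mul_assoc, ← add_mul]
          gcongr
          exact enorm_sub_sq_le _ _ hδ
      _ = ENNReal.ofReal (1 + δ) * ∫⁻ ω, ‖D (x ω)‖ₑ ^ 2 * ‖A (x ω)‖ₑ ^ 2 ∂μ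
          + ENNReal.ofReal (1 + δ⁻¹) * ∫⁻ ω, ‖ε ω‖ₑ ^ 2 * ‖A (x ω)‖ₑ ^ 2 ∂μ := by
          have hm : AEMeasurable (fun ω =>
              ENNReal.ofReal (1 + δ) * (‖D (x ω)‖ₑ ^ 2 * ‖A (x ω)‖ₑ ^ 2)) μ :=
            ((hmD.pow_const 2).mul (hmA.pow_const 2)).const_mul _
          rw [lintegral_add_left' hm,
            lintegral_const_mul' _ _ ENNReal.ofReal_ne_top,
            lintegral_const_mul' _ _ ENNReal.ofReal_ne_top]
      _ ≤ ENNReal.ofReal (1 + δ) * (ENNReal.ofReal c * sqMoment μ x D * sqMoment μ x A)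
          + ENNReal.ofReal (1 + δ⁻¹) * ((∫⁻ ω, ‖ε ω‖ₑ ^ 2 ∂μ) * sqMoment μ x A) := by
          rw [h2]
          gcongr
      _ = _ := by ring
  have hεfin : ∫⁻ ω, ‖ε ω‖ₑ ^ 2 ∂μ ≠ ∞ := by
    rw [← ofReal_integral_norm_sq hε]
    exact ENNReal.ofReal_ne_top
  have hG : MemLp (fun ω => Θ (W ω)) 2 μ := by
    refine memLp_two_of_lintegral_ne_top (Θ.integrable_comp hWi).1
      (ne_top_of_le_ne_top ?_ hnoise)
    have := sqMoment_ne_top hx D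
    have := sqMoment_ne_top hx A
    finiteness
  have hmain := lintegral_enorm_sub_smul_sq_le hG (Θ D) η
  rw [Θ.integral_comp_comm hWi, hWm, ← map_smul, ← map_sub, hΘsq] at hmain
  simp_rw [← map_smul, ← map_sub, hΘsq] at hmain
  refine hmain.trans ?_
  have hop : (D - η • (D ∘L covOp μ x)) ∘L R = D ∘L ((1 - η • covOp μ x) ∘L R) := by
    ext v
    simp
  rw [hop]
  simp_rw [hΘsq] at hnoise
  gcongr

end step

/-! ### The iterates as functions of an independent sample -/

section sgd

variable {H₁ : Type*} [NormedAddCommGroup H₁] [InnerProductSpace ℝ H₁]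
variable {H₂ : Type*} [NormedAddCommGroup H₂] [InnerProductSpace ℝ H₂]

lemma sgd_congr (η : ℕ → ℝ) {z z' : ℕ → H₁ × H₂} {t : ℕ} (h : ∀ j ∈ Finset.Icc 1 t, z j = z' j) :
    sgd η z t = sgd η z' t := by
  induction t with
  | zero => rfl
  | succ t ih =>
    have h1 := ih fun j hj => h j (Finset.Icc_subset_Icc_right (Nat.le_succ t) hj)
    have h2 := h (t + 1) (by simp)
    simp only [sgd, h1, h2]

lemma continuous_sgd (η : ℕ → ℝ) (t : ℕ) : Continuous fun z : ℕ → H₁ × H₂ => sgd η z t := by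
  induction t with
  | zero => exact continuous_const
  | succ t ih =>
    have h1 : Continuous fun z : ℕ → H₁ × H₂ => (z (t + 1)).1 :=
      continuous_fst.comp (continuous_apply _)
    have h2 : Continuous fun z : ℕ → H₁ × H₂ => (z (t + 1)).2 :=
      continuous_snd.comp (continuous_apply _)
    have h3 : Continuous fun z : ℕ → H₁ × H₂ =>
        (sgd η z t (z (t + 1)).1 - (z (t + 1)).2, (z (t + 1)).1) :=
      ((ih.clm_apply h1).sub h2).prodMk h1
    have h4 : Continuous fun z : ℕ → H₁ × H₂ => η (t + 1) •
        InnerProductSpace.rankOne ℝ (sgd η z t (z (t + 1)).1 - (z (t + 1)).2) (z (t + 1)).1 :=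
      (continuous_rankOne.comp h3).const_smul (η (t + 1))
    exact ih.sub h4

lemma isCompactOperator_sgd (η : ℕ → ℝ) (z : ℕ → H₁ × H₂) (t : ℕ) :
    IsCompactOperator (sgd η z t) := by
  have h : sgd η z t ∈ compactOperator (RingHom.id ℝ) H₁ H₂ := by
    induction t with
    | zero => exact Submodule.zero_mem _
    | succ t ih =>
      exact Submodule.sub_mem _ ih (Submodule.smul_mem _ _ (isCompactOperator_rankOne _ _))
  exact h

end sgd

lemma lintegral_comp_indepFun {Ω Ω' V E : Type*} [MeasurableSpace Ω] [MeasurableSpace Ω']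
    [MeasurableSpace V] [MeasurableSpace E] {μ : Measure Ω} {P : Measure Ω'} [IsProbabilityMeasure P]
    {U : Ω' → V} {Z : Ω' → E} {p : Ω → E} (hU : AEMeasurable U P) (hZ : IdentDistrib Z p P μ)
    (hind : IndepFun U Z P) {h : V × E → ℝ≥0∞} (hh : Measurable h) :
    ∫⁻ ω', h (U ω', Z ω') ∂P = ∫⁻ ω', ∫⁻ ω, h (U ω', p ω) ∂μ ∂P := by
  have := hind.map_prod_eq_prod_map_map hU hZ.aemeasurable_fst
  have hp : IsProbabilityMeasure (P.map Z) := Measure.isProbabilityMeasure_map hZ.aemeasurable_fst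
  rw [← lintegral_map' (f := h) hh.aemeasurable (hU.prodMk hZ.aemeasurable_fst), this,
    lintegral_prod _ hh.aemeasurable, lintegral_map' hh.lintegral_prod_right'.aemeasurable hU]
  refine lintegral_congr fun ω' => ?_
  have hm : Measurable fun e => h (U ω', e) := hh.comp measurable_prodMk_left
  rw [hZ.map_eq, lintegral_map' hm.aemeasurable hZ.aemeasurable_snd]

section sample

variable {H₁ : Type*} [NormedAddCommGroup H₁] [InnerProductSpace ℝ H₁] [MeasurableSpace H₁]
variable {H₂ : Type*} [NormedAddCommGroup H₂] [InnerProductSpace ℝ H₂] [MeasurableSpace H₂]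
variable {Ω : Type*} [MeasurableSpace Ω] {μ : Measure Ω} {p : Ω → H₁ × H₂}
variable {Ω' : Type*} [MeasurableSpace Ω'] {P : Measure Ω'} {T : ℕ} {z : ℕ → Ω' → H₁ × H₂}

/-- The iterate after `t` steps is a continuous function of the first `t` data points, which are
independent of the next one. -/
lemma IsIIDSample.exists_factorization (hz : IsIIDSample μ p P T z) (η : ℕ → ℝ) {t : ℕ}
    (ht : t ≤ T) :
    ∃ (κ : Type) (_ : Fintype κ) (Z : Ω' → κ → H₁ × H₂) (F : (κ → H₁ × H₂) → H₁ →L[ℝ] H₂),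
      AEMeasurable Z P ∧ Continuous F ∧ (∀ ω', sgd η (fun j => z j ω') t = F (Z ω')) ∧
      (t + 1 ≤ T → IndepFun Z (z (t + 1)) P) := by
  classical
  let S : Finset (Finset.Icc 1 T) := Finset.univ.filter fun j => (j : ℕ) ≤ t
  have hmeas : ∀ j : Finset.Icc 1 T, AEMeasurable (z j) P := fun j =>
    (hz.ident j j.2).aemeasurable_fst
  have hmem : ∀ {j : ℕ}, j ∈ Finset.Icc 1 t → j ∈ Finset.Icc 1 T := fun hj =>
    Finset.Icc_subset_Icc_right ht hj
  let ext : (S → H₁ × H₂) → ℕ → H₁ × H₂ := fun u j =>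
    if hj : j ∈ Finset.Icc 1 t then
      u ⟨⟨j, hmem hj⟩, Finset.mem_filter.2 ⟨Finset.mem_univ _, (Finset.mem_Icc.1 hj).2⟩⟩ else 0
  have hext : Continuous ext := by
    refine continuous_pi fun j => ?_
    by_cases hj : j ∈ Finset.Icc 1 t
    · simp only [ext, hj, dite_true]
      exact continuous_apply _
    · simp only [ext, hj, dite_false]
      exact continuous_const
  refine ⟨S, inferInstance, fun ω' i => z i ω', fun u => sgd η (ext u) t,
    aemeasurable_pi_lambda _ fun i => hmeas i, (continuous_sgd η t).comp hext, fun ω' => ?_,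
    fun ht' => ?_⟩
  · refine sgd_congr η fun j hj => ?_
    simp only [ext, hj, dite_true]
  · let j₀ : Finset.Icc 1 T := ⟨t + 1, Finset.mem_Icc.2 ⟨by omega, ht'⟩⟩
    have h := hz.indep.indepFun_finset₀ S {j₀} (by simp [S, j₀]) hmeas
    have hψ : Measurable fun u : ({j₀} : Finset (Finset.Icc 1 T)) → H₁ × H₂ =>
        u ⟨j₀, Finset.mem_singleton_self _⟩ := measurable_pi_apply _
    exact h.comp measurable_id hψ

variable [TopologicalSpace.SeparableSpace H₁] [BorelSpace H₁]
  [TopologicalSpace.SeparableSpace H₂] [BorelSpace H₂]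

lemma IsIIDSample.aemeasurable_sgd (hz : IsIIDSample μ p P T z) (η : ℕ → ℝ) {t : ℕ}
    (ht : t ≤ T) {g : (H₁ →L[ℝ] H₂) → ℝ≥0∞} (hg : Continuous g) :
    AEMeasurable (fun ω' => g (sgd η (fun j => z j ω') t)) P := by
  have := UniformSpace.secondCountable_of_separable H₁
  have := UniformSpace.secondCountable_of_separable H₂
  obtain ⟨κ, _, Z, F, hZ, hF, hS, -⟩ := hz.exists_factorization η ht
  simp_rw [hS]
  exact (hg.comp hF).measurable.comp_aemeasurable hZ

/-- The expectation over the next data point can be taken first, for a fixed iterate. -/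
lemma IsIIDSample.lintegral_sgd [IsProbabilityMeasure P] (hz : IsIIDSample μ p P T z) (η : ℕ → ℝ) {t : ℕ}
    (ht : t + 1 ≤ T) {g : (H₁ →L[ℝ] H₂) × (H₁ × H₂) → ℝ≥0∞} (hg : Continuous g) :
    ∫⁻ ω', g (sgd η (fun j => z j ω') t, z (t + 1) ω') ∂P
      = ∫⁻ ω', ∫⁻ ω, g (sgd η (fun j => z j ω') t, p ω) ∂μ ∂P := by
  have := UniformSpace.secondCountable_of_separable H₁
  have := UniformSpace.secondCountable_of_separable H₂
  obtain ⟨κ, _, Z, F, hZ, hF, hS, hind⟩ := hz.exists_factorization η (Nat.le_of_succ_le ht)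
  simp_rw [hS]
  have hc : Continuous fun q : (κ → H₁ × H₂) × (H₁ × H₂) => g (F q.1, q.2) :=
    hg.comp ((hF.comp continuous_fst).prodMk continuous_snd)
  exact lintegral_comp_indepFun (h := fun q : (κ → H₁ × H₂) × (H₁ × H₂) => g (F q.1, q.2)) hZ
    (hz.ident (t + 1) (Finset.mem_Icc.2 ⟨by omega, ht⟩)) (hind ht) hc.measurable

end sample

/-! ### The mean error -/

section meanErr

variable {H₁ : Type*} [NormedAddCommGroup H₁] [InnerProductSpace ℝ H₁]
variable {H₂ : Type*} [NormedAddCommGroup H₂] [InnerProductSpace ℝ H₂]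
variable {Ω : Type*} [MeasurableSpace Ω] {μ : Measure Ω} {x : Ω → H₁}
variable {Ω' : Type*} [MeasurableSpace Ω'] {P : Measure Ω'}

/-- The mean over the sample of `𝔼 ‖(S_{t+1} - S†) R x‖ ^ 2`, for a fixed operator `R`. With `R = 1`
it is the mean excess risk after `t` steps. -/
noncomputable def meanErr (μ : Measure Ω) (x : Ω → H₁) (P : Measure Ω') (z : ℕ → Ω' → H₁ × H₂)
    (η : ℕ → ℝ) (Sd : H₁ →L[ℝ] H₂) (t : ℕ) (R : H₁ →L[ℝ] H₁) : ℝ≥0∞ :=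
  ∫⁻ ω', sqMoment μ x ((sgd η (fun j => z j ω') t - Sd) ∘L R) ∂P

lemma meanErr_zero [IsProbabilityMeasure P] (z : ℕ → Ω' → H₁ × H₂) (η : ℕ → ℝ)
    (Sd : H₁ →L[ℝ] H₂) (R : H₁ →L[ℝ] H₁) :
    meanErr μ x P z η Sd 0 R = sqMoment μ x (Sd ∘L R) := by
  simp [meanErr, sgd, sqMoment]

variable [CompleteSpace H₁] [CompleteSpace H₂]
  [TopologicalSpace.SeparableSpace H₁] [MeasurableSpace H₁] [BorelSpace H₁]
  [TopologicalSpace.SeparableSpace H₂] [MeasurableSpace H₂] [BorelSpace H₂]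
  [IsProbabilityMeasure μ] [IsProbabilityMeasure P]
  {ε y : Ω → H₂} {Sd : H₁ →L[ℝ] H₂} {T : ℕ} {z : ℕ → Ω' → H₁ × H₂}

lemma meanErr_succ_le
    (hx : MemLp x 2 μ) (hε : MemLp ε 2 μ) (hε0 : ∫ ω, ε ω ∂μ = 0) (hind : IndepFun x ε μ)
    (hy : ∀ ω, y ω = Sd (x ω) + ε ω) (hSd : IsCompactOperator Sd)
    {c : ℝ} (hm1 : MomentCondition μ x H₁ c) (hm2 : MomentCondition μ x H₂ c)
    (hz : IsIIDSample μ (fun ω => (x ω, y ω)) P T z) (η : ℕ → ℝ) {t : ℕ} (ht : t + 1 ≤ T)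
    (R : H₁ →L[ℝ] H₁) {A : H₁ →L[ℝ] H₁} (hA : IsCompactOperator A)
    (hAR : ∀ u, ∫⁻ ω, ‖inner ℝ u (R (x ω))‖ₑ ^ 2 ∂μ = ‖A u‖ₑ ^ 2) {δ : ℝ} (hδ : 0 < δ) :
    meanErr μ x P z η Sd (t + 1) R
      ≤ meanErr μ x P z η Sd t ((1 - η (t + 1) • covOp μ x) ∘L R)
        + ENNReal.ofReal (η (t + 1) ^ 2) *
          ((ENNReal.ofReal (1 + δ) * ENNReal.ofReal c * meanErr μ x P z η Sd t 1
            + ENNReal.ofReal (1 + δ⁻¹) * ∫⁻ ω, ‖ε ω‖ₑ ^ 2 ∂μ) * sqMoment μ x A) := by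
  have hg : Continuous fun q : (H₁ →L[ℝ] H₂) × (H₁ × H₂) => sqMoment μ x
      ((q.1 - η (t + 1) • InnerProductSpace.rankOne ℝ (q.1 q.2.1 - q.2.2) q.2.1 - Sd) ∘L R) := by
    have h1 : Continuous fun q : (H₁ →L[ℝ] H₂) × (H₁ × H₂) => (q.1 q.2.1 - q.2.2, q.2.1) :=
      ((continuous_fst.clm_apply (continuous_fst.comp continuous_snd)).sub
        (continuous_snd.comp continuous_snd)).prodMk (continuous_fst.comp continuous_snd)
    have h2 : Continuous fun q : (H₁ →L[ℝ] H₂) × (H₁ × H₂) =>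
        η (t + 1) • InnerProductSpace.rankOne ℝ (q.1 q.2.1 - q.2.2) q.2.1 :=
      (continuous_rankOne.comp h1).const_smul (η (t + 1))
    exact (continuous_sqMoment hx).comp
      ((((continuous_fst.sub h2).sub continuous_const)).clm_comp continuous_const)
  have hσ : ∫⁻ ω, ‖ε ω‖ₑ ^ 2 ∂μ ≠ ∞ := by
    rw [← ofReal_integral_norm_sq hε]
    exact ENNReal.ofReal_ne_top
  have hAfin := sqMoment_ne_top hx A
  have hcont : ∀ B : H₁ →L[ℝ] H₁,
      Continuous fun S : H₁ →L[ℝ] H₂ => sqMoment μ x ((S - Sd) ∘L B) := fun B =>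
    (continuous_sqMoment hx).comp ((continuous_id.sub continuous_const).clm_comp continuous_const)
  set k : ℝ≥0∞ := ENNReal.ofReal (1 + δ) * ENNReal.ofReal c with hk
  set w : ℝ≥0∞ := ENNReal.ofReal (1 + δ⁻¹) * ∫⁻ ω, ‖ε ω‖ₑ ^ 2 ∂μ with hw
  have hkfin : k ≠ ∞ := by finiteness
  have hwfin : w ≠ ∞ := by finiteness
  calc meanErr μ x P z η Sd (t + 1) R
      = ∫⁻ ω', ∫⁻ ω, sqMoment μ x ((sgd η (fun j => z j ω') t - η (t + 1) •
          InnerProductSpace.rankOne ℝ (sgd η (fun j => z j ω') t (x ω) - y ω) (x ω) - Sd) ∘L R)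
          ∂μ ∂P := hz.lintegral_sgd η ht hg
    _ ≤ ∫⁻ ω', (sqMoment μ x ((sgd η (fun j => z j ω') t - Sd) ∘L
            ((1 - η (t + 1) • covOp μ x) ∘L R))
          + ENNReal.ofReal (η (t + 1) ^ 2) *
            ((k * sqMoment μ x (sgd η (fun j => z j ω') t - Sd) + w) * sqMoment μ x A)) ∂P := by
        refine lintegral_mono fun ω' => ?_
        refine le_trans (le_of_eq (lintegral_congr fun ω => ?_))
          (lintegral_sqMoment_step_le hx hε hε0 hind hm1 hm2
            ((isCompactOperator_sgd η (fun j => z j ω') t).sub hSd) R hA hAR (η (t + 1)) hδ)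
        rw [hy, sub_apply, sub_right_comm, sub_sub (sgd η (fun j => z j ω') t (x ω))]
    _ = _ := by
        have hm1' := hz.aemeasurable_sgd η (Nat.le_of_succ_le ht)
          (hcont ((1 - η (t + 1) • covOp μ x) ∘L R))
        have hm2' := hz.aemeasurable_sgd η (Nat.le_of_succ_le ht) (hcont 1)
        rw [lintegral_add_left' hm1', lintegral_const_mul' _ _ ENNReal.ofReal_ne_top,
          lintegral_mul_const' _ _ hAfin, lintegral_add_right _ measurable_const,
          lintegral_const_mul' _ _ hkfin, lintegral_const, measure_univ, mul_one]
        rfl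

end meanErr

/-! ### The residual polynomials -/

section resid

variable {H : Type*} [NormedAddCommGroup H] [InnerProductSpace ℝ H]

/-- The operator `∏_{j=t+1}^n (1 - η_j L)`, by which steps `t + 1, …, n` act on the error in the
mean. -/
noncomputable def resid (L : H →L[ℝ] H) (η : ℕ → ℝ) (n t : ℕ) : H →L[ℝ] H :=
  Polynomial.aeval L (∏ j ∈ Finset.Icc (t + 1) n,
    (1 - Polynomial.C (η j) * Polynomial.X : Polynomial ℝ))

lemma resid_self (L : H →L[ℝ] H) (η : ℕ → ℝ) (n : ℕ) : resid L η n n = 1 := by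
  simp [resid]

lemma resid_eq_comp (L : H →L[ℝ] H) (η : ℕ → ℝ) {n t : ℕ} (ht : t < n) :
    resid L η n t = (1 - η (t + 1) • L) ∘L resid L η n (t + 1) := by
  have h : Finset.Icc (t + 1) n = insert (t + 1) (Finset.Icc (t + 1 + 1) n) := by
    ext j
    simp only [Finset.mem_Icc, Finset.mem_insert]
    omega
  rw [resid, h, Finset.prod_insert (by simp), map_mul, resid]
  simp [ContinuousLinearMap.mul_def, Algebra.smul_def]

lemma IsDiag.resid {ι : Type*} {b : HilbertBasis ι ℝ H} {L : H →L[ℝ] H} {l : ι → ℝ}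
    (hL : IsDiag b L l) (η : ℕ → ℝ) (n t : ℕ) :
    IsDiag b (resid L η n t) (fun i => ∏ j ∈ Finset.Icc (t + 1) n, (1 - η j * l i)) := by
  have h := hL.aeval (∏ j ∈ Finset.Icc (t + 1) n,
    (1 - Polynomial.C (η j) * Polynomial.X : Polynomial ℝ))
  simp only [Polynomial.eval_prod, Polynomial.eval_sub, Polynomial.eval_one, Polynomial.eval_mul,
    Polynomial.eval_C, Polynomial.eval_X] at h
  exact h

end resid

/-- For `R` diagonal in the eigenbasis, `L ^ (1/2) R` computes the quadratic form `R L R`. -/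
lemma IsDiag.lintegral_inner_sq {H : Type*} [NormedAddCommGroup H] [InnerProductSpace ℝ H]
    [CompleteSpace H] {Ω : Type*} [MeasurableSpace Ω] {μ : Measure Ω} {x : Ω → H}
    (hx : MemLp x 2 μ) {ι : Type*} {b : HilbertBasis ι ℝ H} {l : ι → ℝ}
    (hL : IsDiag b (covOp μ x) l) (hsum : Summable l) {R : H →L[ℝ] H} {q : ι → ℝ}
    (hR : IsDiag b R q) (u : H) :
    ∫⁻ ω, ‖inner ℝ u (R (x ω))‖ₑ ^ 2 ∂μ = ‖(OperatorSGD.opPow (covOp μ x) (1 / 2) ∘L R) u‖ₑ ^ 2 := by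
  have hl := eigenvalue_nonneg hx hL
  have h1 : ∀ ω, inner ℝ u (R (x ω)) = inner ℝ (R u) (x ω) := fun ω => by
    rw [← ContinuousLinearMap.adjoint_inner_left, hR.adjoint_eq]
  have h2 : MemLp (fun ω => inner ℝ (R u) (x ω)) 2 μ := hx.const_inner (R u)
  simp_rw [h1]
  rw [← ofReal_integral_norm_sq h2, ← ofReal_norm, ← ENNReal.ofReal_pow (norm_nonneg _)]
  congr 1
  have h3 := inner_covOp hx (R u) (R u)
  simp_rw [← sq] at h3
  simp_rw [Real.norm_eq_abs, sq_abs]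
  rw [← h3, real_inner_comm, ContinuousLinearMap.comp_apply]
  refine (hL.hasSum_inner (R u)).unique
    (((hL.opPow hl hsum (by norm_num : (0 : ℝ) < 1 / 2)).hasSum_norm_sq (R u)).congr_fun ?_)
  intro i
  rw [← Real.rpow_natCast (l i ^ (1 / 2 : ℝ)), ← Real.rpow_mul (hl i)]
  norm_num

section unroll

variable {H₁ : Type*} [NormedAddCommGroup H₁] [InnerProductSpace ℝ H₁] [CompleteSpace H₁]
  [TopologicalSpace.SeparableSpace H₁] [MeasurableSpace H₁] [BorelSpace H₁]
variable {H₂ : Type*} [NormedAddCommGroup H₂] [InnerProductSpace ℝ H₂] [CompleteSpace H₂]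
  [TopologicalSpace.SeparableSpace H₂] [MeasurableSpace H₂] [BorelSpace H₂]
variable {Ω : Type*} [MeasurableSpace Ω] {μ : Measure Ω} [IsProbabilityMeasure μ] {x : Ω → H₁}
  {ε y : Ω → H₂} {Sd : H₁ →L[ℝ] H₂}
variable {Ω' : Type*} [MeasurableSpace Ω'] {P : Measure Ω'} [IsProbabilityMeasure P]
  {T : ℕ} {z : ℕ → Ω' → H₁ × H₂}

/-- The bias-variance decomposition of the mean error after `n` steps. The variance is expressed by
a bound `W` on the size of the noise in the preceding steps, which includes their mean errors. -/
lemma meanErr_le_bias_add_variance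
    (hx : MemLp x 2 μ) (hε : MemLp ε 2 μ) (hε0 : ∫ ω, ε ω ∂μ = 0) (hind : IndepFun x ε μ)
    (hy : ∀ ω, y ω = Sd (x ω) + ε ω) (hSd : IsCompactOperator Sd)
    {c : ℝ} (hm1 : MomentCondition μ x H₁ c) (hm2 : MomentCondition μ x H₂ c)
    {ι : Type*} {b : HilbertBasis ι ℝ H₁} {l : ι → ℝ} (hL : IsDiag b (covOp μ x) l)
    (hsum : Summable l)
    (hz : IsIIDSample μ (fun ω => (x ω, y ω)) P T z) (η : ℕ → ℝ) {n : ℕ} (hn : n ≤ T)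
    {δ : ℝ} (hδ : 0 < δ) {W : ℝ≥0∞}
    (hW : ∀ t < n, ENNReal.ofReal (1 + δ) * ENNReal.ofReal c * meanErr μ x P z η Sd t 1
            + ENNReal.ofReal (1 + δ⁻¹) * ∫⁻ ω, ‖ε ω‖ₑ ^ 2 ∂μ ≤ W) :
    meanErr μ x P z η Sd n 1 ≤ sqMoment μ x (Sd ∘L resid (covOp μ x) η n 0)
      + W * ∑ t ∈ Finset.Icc 1 n, ENNReal.ofReal (η t ^ 2) *
        ∑' i, ENNReal.ofReal (l i ^ 2 * (∏ j ∈ Finset.Icc (t + 1) n, (1 - η j * l i)) ^ 2) := by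
  have hl := eigenvalue_nonneg hx hL
  have hhalf := hL.opPow hl hsum (by norm_num : (0 : ℝ) < 1 / 2)
  have key : ∀ m ≤ n, meanErr μ x P z η Sd m (resid (covOp μ x) η n m)
      ≤ sqMoment μ x (Sd ∘L resid (covOp μ x) η n 0)
      + W * ∑ t ∈ Finset.Icc 1 m, ENNReal.ofReal (η t ^ 2) *
        ∑' i, ENNReal.ofReal (l i ^ 2 * (∏ j ∈ Finset.Icc (t + 1) n, (1 - η j * l i)) ^ 2) := by
    intro m
    induction m with
    | zero => exact fun _ => by simp [meanErr_zero]
    | succ m ih =>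
      intro hm
      have hR := hL.resid η n (m + 1)
      have hstep := meanErr_succ_le hx hε hε0 hind hy hSd hm1 hm2 hz η (hm.trans hn)
        (resid (covOp μ x) η n (m + 1))
        (A := opPow (covOp μ x) (1 / 2) ∘L resid (covOp μ x) η n (m + 1))
        ((hL.isCompactOperator_opPow (isCompactOperator_covOp hx) hl hsum
          (by norm_num : (0 : ℝ) < 1 / 2)).comp_clm (resid (covOp μ x) η n (m + 1)))
        (hL.lintegral_inner_sq hx hsum hR) hδ
      rw [← resid_eq_comp _ _ (Nat.lt_of_succ_le hm)] at hstep
      have hv : sqMoment μ x (opPow (covOp μ x) (1 / 2) ∘L resid (covOp μ x) η n (m + 1))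
          = ∑' i, ENNReal.ofReal
            (l i ^ 2 * (∏ j ∈ Finset.Icc (m + 1 + 1) n, (1 - η j * l i)) ^ 2) := by
        rw [hL.sqMoment_eq hx (hhalf.comp hR)]
        refine tsum_congr fun i => ?_
        congr 1
        rw [mul_pow, ← Real.rpow_natCast (l i ^ (1 / 2 : ℝ)), ← Real.rpow_mul (hl i)]
        norm_num
        ring
      rw [hv] at hstep
      rw [Finset.sum_Icc_succ_top (by omega), mul_add, ← add_assoc]
      refine hstep.trans (add_le_add (ih (Nat.le_of_succ_le hm)) ?_)
      rw [mul_left_comm]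
      gcongr
      exact hW m (Nat.lt_of_succ_le hm)
  simpa only [resid_self] using key n le_rfl

end unroll

/-! ### Decay of the residual polynomials -/

lemma rpow_mul_exp_le {a σ p : ℝ} (ha : 0 ≤ a) (ha1 : a ≤ 1) (hσ : 0 ≤ σ) (hp : 0 < p) :
    a ^ p * Real.exp (-(2 * a * σ)) ≤ (1 + p / 2) ^ p / (1 + σ) ^ p := by
  have h1 : a * (1 + σ) * Real.exp (-(2 * a * σ / p)) ≤ 1 + p / 2 := by
    set w := 2 * a * σ / p with hw
    have hw0 : 0 ≤ w := by positivity
    have h2 : a * σ = p / 2 * w := by rw [hw]; field_simp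
    have h3 : w * Real.exp (-w) ≤ 1 := by
      rw [Real.exp_neg, ← div_eq_mul_inv, div_le_one (Real.exp_pos _)]
      linarith [Real.add_one_le_exp w]
    have h4 : Real.exp (-w) ≤ 1 := Real.exp_le_one_iff.2 (by linarith)
    calc a * (1 + σ) * Real.exp (-w) = a * Real.exp (-w) + p / 2 * (w * Real.exp (-w)) := by
          rw [mul_add, mul_one, h2]; ring
      _ ≤ 1 * 1 + p / 2 * 1 := by gcongr
      _ = 1 + p / 2 := by ring
  rw [le_div_iff₀ (by positivity)]
  calc a ^ p * Real.exp (-(2 * a * σ)) * (1 + σ) ^ p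
      = (a * (1 + σ) * Real.exp (-(2 * a * σ / p))) ^ p := by
        rw [Real.mul_rpow (by positivity) (Real.exp_pos _).le, Real.mul_rpow ha (by positivity),
          ← Real.exp_mul]
        have : -(2 * a * σ / p) * p = -(2 * a * σ) := by field_simp
        rw [this]
        ring
    _ ≤ (1 + p / 2) ^ p := Real.rpow_le_rpow (by positivity) h1 hp.le

lemma prod_one_sub_sq_le {s : Finset ℕ} {η : ℕ → ℝ} {a : ℝ} (h : ∀ j ∈ s, η j * a ≤ 1) :
    (∏ j ∈ s, (1 - η j * a)) ^ 2 ≤ Real.exp (-(2 * a * ∑ j ∈ s, η j)) := by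
  have h0 : 0 ≤ ∏ j ∈ s, (1 - η j * a) := Finset.prod_nonneg fun j hj => by linarith [h j hj]
  have h1 : ∏ j ∈ s, (1 - η j * a) ≤ ∏ j ∈ s, Real.exp (-(η j * a)) :=
    Finset.prod_le_prod (fun j hj => by linarith [h j hj])
      fun j _ => by linarith [Real.add_one_le_exp (-(η j * a))]
  rw [← Real.exp_sum, Finset.sum_neg_distrib, ← Finset.sum_mul] at h1
  calc (∏ j ∈ s, (1 - η j * a)) ^ 2 ≤ Real.exp (-((∑ j ∈ s, η j) * a)) ^ 2 := by gcongr
    _ = _ := by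
      rw [← Real.exp_nat_mul]
      congr 1
      push_cast
      ring

/-- The sum `Tr(L ^ (s + p) Q ^ 2)` for a residual polynomial `Q`, against `Tr(L ^ s)`. -/
lemma tsum_rpow_mul_prod_sq_le {ι : Type*} {l : ι → ℝ} (hl : ∀ i, 0 ≤ l i) (hl1 : ∀ i, l i ≤ 1)
    {η : ℕ → ℝ} {J : Finset ℕ} (hη : ∀ j ∈ J, 0 ≤ η j) (hηl : ∀ j ∈ J, ∀ i, η j * l i ≤ 1)
    {s p q : ℝ} (hs : 0 < s) (hp : 0 < p) (hq : q = s + p) :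
    ∑' i, ENNReal.ofReal (l i ^ q * (∏ j ∈ J, (1 - η j * l i)) ^ 2)
      ≤ ENNReal.ofReal ((1 + p / 2) ^ p / (1 + ∑ j ∈ J, η j) ^ p)
        * ∑' i, ENNReal.ofReal (l i ^ s) := by
  rw [← ENNReal.tsum_mul_left]
  refine ENNReal.tsum_le_tsum fun i => ?_
  have hσ : 0 ≤ ∑ j ∈ J, η j := Finset.sum_nonneg hη
  rw [← ENNReal.ofReal_mul (by positivity)]
  refine ENNReal.ofReal_le_ofReal ?_
  rw [hq, Real.rpow_add_of_nonneg (hl i) hs.le hp.le, mul_assoc, mul_comm]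
  refine mul_le_mul_of_nonneg_right ?_ (Real.rpow_nonneg (hl i) _)
  refine le_trans ?_ (rpow_mul_exp_le (hl i) (hl1 i) hσ hp)
  exact mul_le_mul_of_nonneg_left (prod_one_sub_sq_le fun j hj => hηl j hj i)
    (Real.rpow_nonneg (hl i) _)

/-! ### Sums of step sizes -/

section steps

variable {η₁ θ : ℝ}

lemma polyStep_nonneg (hη : 0 ≤ η₁) (t : ℕ) : 0 ≤ polyStep η₁ θ t := by
  unfold polyStep
  positivity

lemma polyStep_le (hη : 0 ≤ η₁) (hθ : 0 ≤ θ) {t : ℕ} (ht : 1 ≤ t) : polyStep η₁ θ t ≤ η₁ := by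
  unfold polyStep
  have : (t : ℝ) ^ (-θ) ≤ 1 :=
    Real.rpow_le_one_of_one_le_of_nonpos (by exact_mod_cast ht) (by linarith)
  nlinarith

lemma mul_rpow_le_sum_polyStep (hη : 0 ≤ η₁) (hθ : 0 ≤ θ) {t T : ℕ} (ht : t ≤ T) :
    η₁ * ((T : ℝ) - t) * (T : ℝ) ^ (-θ) ≤ ∑ j ∈ Finset.Icc (t + 1) T, polyStep η₁ θ j := by
  have h : ∀ j ∈ Finset.Icc (t + 1) T, η₁ * (T : ℝ) ^ (-θ) ≤ polyStep η₁ θ j := by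
    intro j hj
    obtain ⟨h1, h2⟩ := Finset.mem_Icc.1 hj
    unfold polyStep
    refine mul_le_mul_of_nonneg_left ?_ hη
    exact Real.rpow_le_rpow_of_nonpos (by exact_mod_cast (by omega : 0 < j))
      (by exact_mod_cast h2) (by linarith)
  refine le_trans (le_of_eq ?_) (Finset.card_nsmul_le_sum _ _ _ h)
  rw [Nat.card_Icc, nsmul_eq_mul, show T + 1 - (t + 1) = T - t by omega, Nat.cast_sub ht]
  ring

lemma sum_inv_le_one_add_log (T : ℕ) :
    ∑ t ∈ Finset.Icc 1 T, ((t : ℝ))⁻¹ ≤ 1 + Real.log T := by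
  have h := harmonic_le_one_add_log T
  rw [harmonic_eq_sum_Icc] at h
  push_cast at h
  exact h

lemma sum_rpow_neg_le_mul_log {T : ℕ} (hθ : θ ≤ 1 / 2) :
    ∑ t ∈ Finset.Icc 1 T, (t : ℝ) ^ (-(2 * θ)) ≤ (T : ℝ) ^ (1 - 2 * θ) * (1 + Real.log T) := by
  refine le_trans ?_ (mul_le_mul_of_nonneg_left (sum_inv_le_one_add_log T)
    (Real.rpow_nonneg T.cast_nonneg _))
  rw [Finset.mul_sum]
  refine Finset.sum_le_sum fun t ht => ?_
  obtain ⟨h1, h2⟩ := Finset.mem_Icc.1 ht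
  have ht0 : (0 : ℝ) < t := by exact_mod_cast h1
  calc (t : ℝ) ^ (-(2 * θ)) = (t : ℝ) ^ (1 - 2 * θ) * (t : ℝ)⁻¹ := by
        rw [← Real.rpow_neg_one, ← Real.rpow_add ht0]
        congr 1
        ring
    _ ≤ (T : ℝ) ^ (1 - 2 * θ) * (t : ℝ)⁻¹ := by
        gcongr
        linarith

lemma exists_sum_rpow_neg_le (hθ : 1 / 2 < θ) :
    ∃ C : ℝ, 0 ≤ C ∧ ∀ T : ℕ, ∑ t ∈ Finset.Icc 1 T, (t : ℝ) ^ (-(2 * θ)) ≤ C := by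
  have hs : Summable fun n : ℕ => (n : ℝ) ^ (-(2 * θ)) :=
    Real.summable_nat_rpow.2 (by linarith)
  exact ⟨_, tsum_nonneg fun n => by positivity,
    fun T => hs.sum_le_tsum _ fun n _ => by positivity⟩

lemma rpow_neg_mul_one_add_log_le {e x : ℝ} (he : 0 < e) (hx : 1 ≤ x) :
    x ^ (-e) * (1 + Real.log x) ≤ 1 + 1 / e := by
  have h1 : Real.log x ≤ x ^ e / e := Real.log_le_rpow_div (by linarith) he
  have h2 : x ^ (-e) ≤ 1 := Real.rpow_le_one_of_one_le_of_nonpos hx (by linarith)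
  have h3 : x ^ (-e) * x ^ e = 1 := by
    rw [← Real.rpow_add (by linarith), neg_add_cancel, Real.rpow_zero]
  calc x ^ (-e) * (1 + Real.log x) ≤ x ^ (-e) * (1 + x ^ e / e) := by gcongr
    _ = x ^ (-e) + (x ^ (-e) * x ^ e) / e := by ring
    _ ≤ 1 + 1 / e := by rw [h3]; gcongr

/-- Comparison of `∑ (1 + a k) ^ (-p)` with the integral of the same function. -/
lemma sum_one_add_mul_rpow_neg_le {a p : ℝ} (ha : 0 < a) (hp : 1 < p) (N : ℕ) :
    ∑ k ∈ Finset.Icc 1 N, (1 + a * k) ^ (-p) ≤ 1 / (a * (p - 1)) := by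
  have key : ∀ N : ℕ, a * (p - 1) * ∑ k ∈ Finset.Icc 1 N, (1 + a * k) ^ (-p)
      ≤ 1 - (1 + a * N) ^ (1 - p) := by
    intro N
    induction N with
    | zero => simp
    | succ N ih =>
      rw [Finset.sum_Icc_succ_top (by omega), mul_add]
      set u : ℝ := 1 + a * ((N + 1 : ℕ) : ℝ) with hu
      set v : ℝ := 1 + a * (N : ℝ) with hv
      have hv0 : 0 < v := by positivity
      have hu0 : 0 < u := by positivity
      have huv : u - v = a := by rw [hu, hv]; push_cast; ring
      -- convexity of `y ↦ y ^ (1 - p)`, at `u` and `v = u - a`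
      have h1 : 1 + (1 - p) * (v / u - 1) ≤ (v / u) ^ (1 - p) := by
        have h2 := Real.log_le_sub_one_of_pos (div_pos hv0 hu0)
        rw [Real.rpow_def_of_pos (div_pos hv0 hu0)]
        have h3 := Real.add_one_le_exp (Real.log (v / u) * (1 - p))
        nlinarith
      have h4 : u ^ (1 - p) + a * (p - 1) * u ^ (-p) ≤ v ^ (1 - p) := by
        have h5 : v ^ (1 - p) = (v / u) ^ (1 - p) * u ^ (1 - p) := by
          rw [← Real.mul_rpow (div_pos hv0 hu0).le hu0.le, div_mul_cancel₀ _ hu0.ne']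
        have h6 : u ^ (1 - p) = u * u ^ (-p) := by
          rw [sub_eq_add_neg, Real.rpow_add hu0, Real.rpow_one]
        have h7 : u ^ (1 - p) + a * (p - 1) * u ^ (-p)
            = (1 + (1 - p) * (v / u - 1)) * u ^ (1 - p) := by
          rw [h6, ← huv]
          field_simp
          ring
        rw [h5, h7]
        exact mul_le_mul_of_nonneg_right h1 (Real.rpow_nonneg hu0.le _)
      linarith
  rw [le_div_iff₀ (mul_pos ha (by linarith)), mul_comm]
  have : 0 ≤ (1 + a * (N : ℝ)) ^ (1 - p) := by positivity
  linarith [key N]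

lemma rpow_neg_le_two_rpow_mul {a : ℝ} (ha : 0 ≤ a) {T : ℕ} (hT : 1 ≤ T) :
    (T : ℝ) ^ (-a) ≤ 2 ^ a * ((T : ℝ) + 1) ^ (-a) := by
  have hT' : (1 : ℝ) ≤ T := by exact_mod_cast hT
  rw [Real.rpow_neg (by positivity), Real.rpow_neg (by positivity), ← div_eq_mul_inv,
    ← Real.div_rpow (by norm_num) (by positivity), ← Real.inv_rpow (by positivity)]
  refine Real.rpow_le_rpow (by positivity) ?_ ha
  rw [inv_eq_one_div, div_le_div_iff₀ (by positivity) (by positivity)]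
  linarith

lemma one_add_log_le_mul_log {T : ℕ} (hT : 1 ≤ T) :
    1 + Real.log T ≤ ((Real.log 2)⁻¹ + 1) * Real.log ((T : ℝ) + 1) := by
  have hT' : (1 : ℝ) ≤ T := by exact_mod_cast hT
  have h2 : 0 < Real.log 2 := Real.log_pos (by norm_num)
  have h3 : Real.log 2 ≤ Real.log ((T : ℝ) + 1) := Real.log_le_log (by norm_num) (by linarith)
  have h4 : Real.log T ≤ Real.log ((T : ℝ) + 1) := Real.log_le_log (by linarith) (by linarith)
  have h5 : 1 ≤ (Real.log 2)⁻¹ * Real.log ((T : ℝ) + 1) := by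
    rw [inv_mul_eq_div, le_div_iff₀ h2]
    linarith
  linarith

/-- The terms with `t ≤ T / 2` have a large denominator, those with `t > T / 2` a small
numerator. -/
lemma sum_polyStep_sq_div_le (hη : 0 < η₁) (hθ : 0 < θ) (hθ1 : θ < 1) {p : ℝ} (hp : 1 ≤ p) {T : ℕ}
    (hT : 1 ≤ T) :
    ∑ t ∈ Finset.Icc 1 (T - 1),
      polyStep η₁ θ t ^ 2 / (1 + ∑ j ∈ Finset.Icc (t + 1) T, polyStep η₁ θ j) ^ p
    ≤ η₁ ^ 2 * (η₁ / 2) ^ (-p) *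
        ((T : ℝ) ^ (-((1 - θ) * p)) * ∑ t ∈ Finset.Icc 1 T, (t : ℝ) ^ (-(2 * θ)))
      + 4 * η₁ ^ 2 * ((T : ℝ) ^ (-(2 * θ)) *
        ∑ k ∈ Finset.Icc 1 (T - 1), (1 + η₁ * (T : ℝ) ^ (-θ) * k) ^ (-p)) := by
  have hT0 : (0 : ℝ) < T := by exact_mod_cast hT
  have hrefl : ∑ k ∈ Finset.Icc 1 (T - 1), (1 + η₁ * (T : ℝ) ^ (-θ) * k) ^ (-p)
      = ∑ t ∈ Finset.Icc 1 (T - 1), (1 + η₁ * (T : ℝ) ^ (-θ) * ((T : ℝ) - t)) ^ (-p) := by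
    refine Finset.sum_nbij' (fun k => T - k) (fun t => T - t) ?_ ?_ ?_ ?_ ?_
    · intro k hk; simp only [Finset.mem_Icc] at hk ⊢; omega
    · intro k hk; simp only [Finset.mem_Icc] at hk ⊢; omega
    · intro k hk; simp only [Finset.mem_Icc] at hk; omega
    · intro k hk; simp only [Finset.mem_Icc] at hk; omega
    · intro k hk
      simp only [Finset.mem_Icc] at hk
      rw [Nat.cast_sub (by omega), sub_sub_cancel]
  have hsub : ∑ t ∈ Finset.Icc 1 (T - 1), (t : ℝ) ^ (-(2 * θ))
      ≤ ∑ t ∈ Finset.Icc 1 T, (t : ℝ) ^ (-(2 * θ)) :=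
    Finset.sum_le_sum_of_subset_of_nonneg (Finset.Icc_subset_Icc_right (Nat.sub_le T 1))
      fun _ _ _ => by positivity
  have hK : 0 ≤ η₁ ^ 2 * (η₁ / 2) ^ (-p) := by positivity
  refine le_trans ?_ (add_le_add_left (mul_le_mul_of_nonneg_left (mul_le_mul_of_nonneg_left hsub
    (Real.rpow_nonneg hT0.le _)) hK) _)
  rw [hrefl, Finset.mul_sum, Finset.mul_sum, Finset.mul_sum, Finset.mul_sum,
    ← Finset.sum_add_distrib]
  refine Finset.sum_le_sum fun t ht => ?_
  obtain ⟨h1, h2⟩ := Finset.mem_Icc.1 ht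
  have ht0 : (0 : ℝ) < t := by exact_mod_cast h1
  have htT : (t : ℝ) ≤ T := by exact_mod_cast (by omega : t ≤ T)
  have htail := mul_rpow_le_sum_polyStep hη.le hθ.le (show t ≤ T by omega)
  set σ := ∑ j ∈ Finset.Icc (t + 1) T, polyStep η₁ θ j with hσ
  have hsq : polyStep η₁ θ t ^ 2 = η₁ ^ 2 * (t : ℝ) ^ (-(2 * θ)) := by
    rw [polyStep, mul_pow, ← Real.rpow_natCast ((t : ℝ) ^ (-θ)), ← Real.rpow_mul ht0.le]
    congr 2
    push_cast
    ring
  have hX : 0 ≤ η₁ ^ 2 * (η₁ / 2) ^ (-p) *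
      ((T : ℝ) ^ (-((1 - θ) * p)) * (t : ℝ) ^ (-(2 * θ))) := by positivity
  have hTt : 0 ≤ (T : ℝ) - t := by linarith
  have hY : 0 ≤ 4 * η₁ ^ 2 * ((T : ℝ) ^ (-(2 * θ)) *
      (1 + η₁ * (T : ℝ) ^ (-θ) * ((T : ℝ) - t)) ^ (-p)) := by positivity
  rw [hsq]
  by_cases hcase : 2 * t ≤ T
  · refine le_trans ?_ (le_add_of_nonneg_right hY)
    have hcase' : 2 * (t : ℝ) ≤ T := by exact_mod_cast hcase
    have hσ1 : η₁ / 2 * (T : ℝ) ^ (1 - θ) ≤ 1 + σ := by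
      have h3 : (T : ℝ) ^ (1 - θ) = T * (T : ℝ) ^ (-θ) := by
        rw [sub_eq_add_neg, Real.rpow_add hT0, Real.rpow_one]
      have h4 : η₁ / 2 * ((T : ℝ) * (T : ℝ) ^ (-θ)) ≤ η₁ * ((T : ℝ) - t) * (T : ℝ) ^ (-θ) := by
        have : 0 ≤ η₁ * (T : ℝ) ^ (-θ) := by positivity
        nlinarith
      rw [h3]
      linarith
    have h5 : (η₁ / 2) ^ (-p) * (T : ℝ) ^ (-((1 - θ) * p)) = ((η₁ / 2 * (T : ℝ) ^ (1 - θ)) ^ p)⁻¹ := by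
      rw [← Real.rpow_neg (by positivity), Real.mul_rpow (by positivity) (by positivity),
        ← Real.rpow_mul hT0.le]
      congr 2
      ring
    calc η₁ ^ 2 * (t : ℝ) ^ (-(2 * θ)) / (1 + σ) ^ p
        ≤ η₁ ^ 2 * (t : ℝ) ^ (-(2 * θ)) / (η₁ / 2 * (T : ℝ) ^ (1 - θ)) ^ p := by
          gcongr
      _ = η₁ ^ 2 * (t : ℝ) ^ (-(2 * θ)) * ((η₁ / 2) ^ (-p) * (T : ℝ) ^ (-((1 - θ) * p))) := by
          rw [h5, div_eq_mul_inv]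
      _ = _ := by ring
  · refine le_trans ?_ (le_add_of_nonneg_left hX)
    have hcase' : (T : ℝ) / 2 ≤ t := by
      have : (T : ℝ) ≤ 2 * t := by exact_mod_cast (by omega : T ≤ 2 * t)
      linarith
    have h3 : (t : ℝ) ^ (-(2 * θ)) ≤ 4 * (T : ℝ) ^ (-(2 * θ)) := by
      calc (t : ℝ) ^ (-(2 * θ)) ≤ ((T : ℝ) / 2) ^ (-(2 * θ)) :=
            Real.rpow_le_rpow_of_nonpos (by positivity) hcase' (by linarith)
        _ = 2 ^ (2 * θ) * (T : ℝ) ^ (-(2 * θ)) := by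
            rw [Real.div_rpow hT0.le (by norm_num), Real.rpow_neg (by norm_num : (0 : ℝ) ≤ 2),
              div_inv_eq_mul, mul_comm]
        _ ≤ 2 ^ (2 : ℝ) * (T : ℝ) ^ (-(2 * θ)) := by
            gcongr
            · norm_num
            · linarith
        _ = 4 * (T : ℝ) ^ (-(2 * θ)) := by norm_num
    have h4 : 1 + η₁ * (T : ℝ) ^ (-θ) * ((T : ℝ) - t) ≤ 1 + σ := by linarith
    have h6 : 0 < 1 + η₁ * (T : ℝ) ^ (-θ) * ((T : ℝ) - t) := by positivity
    calc η₁ ^ 2 * (t : ℝ) ^ (-(2 * θ)) / (1 + σ) ^ p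
        ≤ η₁ ^ 2 * (4 * (T : ℝ) ^ (-(2 * θ))) /
            (1 + η₁ * (T : ℝ) ^ (-θ) * ((T : ℝ) - t)) ^ p := by gcongr
      _ = _ := by
          rw [Real.rpow_neg h6.le]
          ring

lemma sum_one_add_mul_inv_le {a : ℝ} (ha : 0 < a) (T : ℕ) :
    ∑ k ∈ Finset.Icc 1 (T - 1), (1 + a * k) ^ (-(1 : ℝ)) ≤ a⁻¹ * (1 + Real.log T) := by
  refine le_trans ?_ (mul_le_mul_of_nonneg_left (sum_inv_le_one_add_log T) (inv_nonneg.2 ha.le))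
  rw [Finset.mul_sum]
  refine le_trans (Finset.sum_le_sum (g := fun k : ℕ => a⁻¹ * (k : ℝ)⁻¹) fun k hk => ?_)
    (Finset.sum_le_sum_of_subset_of_nonneg (Finset.Icc_subset_Icc_right (Nat.sub_le T 1))
      fun _ _ _ => by positivity)
  have hk0 : (0 : ℝ) < k := by exact_mod_cast (Finset.mem_Icc.1 hk).1
  rw [Real.rpow_neg_one, ← mul_inv]
  gcongr
  linarith

/-- The constant `C(η₁, 1, θ)` is the infimum of a nonempty set. -/
lemma exists_stepSum_le (hη : 0 < η₁) (hθ : 0 < θ) (hθ1 : θ < 1) :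
    ∃ C : ℝ, ∀ T : ℕ, 2 ≤ T → stepSum η₁ θ T ≤ C * stepRate θ T := by
  have hmain : ∀ T : ℕ, 2 ≤ T → stepSum η₁ θ T
      ≤ η₁ ^ 2 * (η₁ / 2) ^ (-(1 : ℝ)) *
        ((T : ℝ) ^ (-(1 - θ)) * ∑ t ∈ Finset.Icc 1 T, (t : ℝ) ^ (-(2 * θ)))
      + 4 * η₁ * ((T : ℝ) ^ (-θ) * (1 + Real.log T)) := by
    intro T hT
    have hT0 : (0 : ℝ) < T := by exact_mod_cast (by omega : 0 < T)
    have h := sum_polyStep_sq_div_le hη hθ hθ1 le_rfl (show 1 ≤ T by omega)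
    simp only [Real.rpow_one, mul_one] at h
    refine h.trans (add_le_add_right ?_ _)
    have ha : 0 < η₁ * (T : ℝ) ^ (-θ) := by positivity
    calc 4 * η₁ ^ 2 * ((T : ℝ) ^ (-(2 * θ)) *
          ∑ k ∈ Finset.Icc 1 (T - 1), (1 + η₁ * (T : ℝ) ^ (-θ) * k) ^ (-(1 : ℝ)))
        ≤ 4 * η₁ ^ 2 * ((T : ℝ) ^ (-(2 * θ)) * ((η₁ * (T : ℝ) ^ (-θ))⁻¹ * (1 + Real.log T))) := by
          gcongr
          exact sum_one_add_mul_inv_le ha T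
      _ = _ := by
          have : (T : ℝ) ^ (-(2 * θ)) = (T : ℝ) ^ (-θ) * (T : ℝ) ^ (-θ) := by
            rw [← Real.rpow_add hT0]
            congr 1
            ring
          rw [this]
          field_simp
  set K := η₁ ^ 2 * (η₁ / 2) ^ (-(1 : ℝ)) with hK
  have hK0 : 0 ≤ K := by positivity
  by_cases hcase : θ ≤ 1 / 2
  · refine ⟨(K + 4 * η₁) * (2 ^ θ * ((Real.log 2)⁻¹ + 1)), fun T hT => (hmain T hT).trans ?_⟩
    have hT0 : (0 : ℝ) < T := by exact_mod_cast (by omega : 0 < T)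
    have hlog : 0 ≤ 1 + Real.log T := by
      have := Real.log_natCast_nonneg T
      linarith
    rw [stepRate, if_pos hcase]
    calc K * ((T : ℝ) ^ (-(1 - θ)) * ∑ t ∈ Finset.Icc 1 T, (t : ℝ) ^ (-(2 * θ)))
          + 4 * η₁ * ((T : ℝ) ^ (-θ) * (1 + Real.log T))
        ≤ K * ((T : ℝ) ^ (-(1 - θ)) * ((T : ℝ) ^ (1 - 2 * θ) * (1 + Real.log T)))
          + 4 * η₁ * ((T : ℝ) ^ (-θ) * (1 + Real.log T)) := by
          gcongr
          exact sum_rpow_neg_le_mul_log hcase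
      _ = (K + 4 * η₁) * ((T : ℝ) ^ (-θ) * (1 + Real.log T)) := by
          rw [← mul_assoc ((T : ℝ) ^ (-(1 - θ))), ← Real.rpow_add hT0,
            show -(1 - θ) + (1 - 2 * θ) = -θ by ring]
          ring
      _ ≤ (K + 4 * η₁) * ((2 ^ θ * ((T : ℝ) + 1) ^ (-θ)) *
            (((Real.log 2)⁻¹ + 1) * Real.log ((T : ℝ) + 1))) := by
          gcongr
          · exact rpow_neg_le_two_rpow_mul hθ.le (by omega)
          · exact one_add_log_le_mul_log (by omega)
      _ = _ := by ring
  · push Not at hcase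
    obtain ⟨C, hC0, hC⟩ := exists_sum_rpow_neg_le hcase
    refine ⟨(K * C + 4 * η₁ * (1 + 1 / (2 * θ - 1))) * 2 ^ (1 - θ),
      fun T hT => (hmain T hT).trans ?_⟩
    have hT0 : (0 : ℝ) < T := by exact_mod_cast (by omega : 0 < T)
    rw [stepRate, if_neg (not_le.2 hcase)]
    have h1 : (T : ℝ) ^ (-θ) * (1 + Real.log T)
        ≤ (T : ℝ) ^ (-(1 - θ)) * (1 + 1 / (2 * θ - 1)) := by
      have h2 : (T : ℝ) ^ (-θ) = (T : ℝ) ^ (-(1 - θ)) * (T : ℝ) ^ (-(2 * θ - 1)) := by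
        rw [← Real.rpow_add hT0]
        congr 1
        ring
      rw [h2, mul_assoc]
      refine mul_le_mul_of_nonneg_left ?_ (by positivity)
      exact rpow_neg_mul_one_add_log_le (by linarith) (by exact_mod_cast (by omega : 1 ≤ T))
    have h3 : 0 ≤ 1 + 1 / (2 * θ - 1) := by
      have : 0 < 2 * θ - 1 := by linarith
      positivity
    calc K * ((T : ℝ) ^ (-(1 - θ)) * ∑ t ∈ Finset.Icc 1 T, (t : ℝ) ^ (-(2 * θ)))
          + 4 * η₁ * ((T : ℝ) ^ (-θ) * (1 + Real.log T))
        ≤ K * ((T : ℝ) ^ (-(1 - θ)) * C)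
          + 4 * η₁ * ((T : ℝ) ^ (-(1 - θ)) * (1 + 1 / (2 * θ - 1))) := by
          gcongr
          exact hC T
      _ = (K * C + 4 * η₁ * (1 + 1 / (2 * θ - 1))) * (T : ℝ) ^ (-(1 - θ)) := by ring
      _ ≤ (K * C + 4 * η₁ * (1 + 1 / (2 * θ - 1))) *
            (2 ^ (1 - θ) * ((T : ℝ) + 1) ^ (-(1 - θ))) := by
          refine mul_le_mul_of_nonneg_left ?_ (by positivity)
          exact rpow_neg_le_two_rpow_mul (by linarith) (by omega)
      _ = _ := by ring

lemma exists_sum_polyStep_sq_div_rpow_le (hη : 0 < η₁) (hθ : 0 < θ) (hθ1 : θ < 1) {p : ℝ}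
    (hp : 1 < p) (hθp : θ ≤ (1 - θ) * p) :
    ∃ C : ℝ, ∀ T : ℕ, 1 ≤ T → ∑ t ∈ Finset.Icc 1 (T - 1),
      polyStep η₁ θ t ^ 2 / (1 + ∑ j ∈ Finset.Icc (t + 1) T, polyStep η₁ θ j) ^ p
        ≤ C * ((T : ℝ) + 1) ^ (-θ) := by
  obtain ⟨C, hC0, hC⟩ : ∃ C : ℝ, 0 ≤ C ∧ ∀ T : ℕ, 1 ≤ T →
      (T : ℝ) ^ (-((1 - θ) * p)) * ∑ t ∈ Finset.Icc 1 T, (t : ℝ) ^ (-(2 * θ))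
        ≤ C * (T : ℝ) ^ (-θ) := by
    by_cases hcase : θ ≤ 1 / 2
    · have he : 0 < (1 - θ) * (p - 1) := mul_pos (by linarith) (by linarith)
      refine ⟨1 + 1 / ((1 - θ) * (p - 1)), by positivity, fun T hT => ?_⟩
      have hT0 : (0 : ℝ) < T := by exact_mod_cast hT
      calc (T : ℝ) ^ (-((1 - θ) * p)) * ∑ t ∈ Finset.Icc 1 T, (t : ℝ) ^ (-(2 * θ))
          ≤ (T : ℝ) ^ (-((1 - θ) * p)) * ((T : ℝ) ^ (1 - 2 * θ) * (1 + Real.log T)) := by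
            gcongr
            exact sum_rpow_neg_le_mul_log hcase
        _ = ((T : ℝ) ^ (-((1 - θ) * (p - 1))) * (1 + Real.log T)) * (T : ℝ) ^ (-θ) := by
            rw [← mul_assoc, ← Real.rpow_add hT0, mul_right_comm, ← Real.rpow_add hT0]
            congr 2
            ring
        _ ≤ _ := by
            refine mul_le_mul_of_nonneg_right ?_ (by positivity)
            exact rpow_neg_mul_one_add_log_le he (by exact_mod_cast hT)
    · push Not at hcase
      obtain ⟨C, hC0, hC⟩ := exists_sum_rpow_neg_le hcase
      refine ⟨C, hC0, fun T hT => ?_⟩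
      rw [mul_comm]
      have hT1 : (1 : ℝ) ≤ T := by exact_mod_cast hT
      have := hC T
      gcongr
  refine ⟨(η₁ ^ 2 * (η₁ / 2) ^ (-p) * C + 4 * η₁ / (p - 1)) * 2 ^ θ, fun T hT => ?_⟩
  have hT0 : (0 : ℝ) < T := by exact_mod_cast hT
  have hp1 : 0 < p - 1 := by linarith
  have ha : 0 < η₁ * (T : ℝ) ^ (-θ) := by positivity
  refine (sum_polyStep_sq_div_le hη hθ hθ1 hp.le hT).trans ?_
  calc η₁ ^ 2 * (η₁ / 2) ^ (-p) *
        ((T : ℝ) ^ (-((1 - θ) * p)) * ∑ t ∈ Finset.Icc 1 T, (t : ℝ) ^ (-(2 * θ)))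
      + 4 * η₁ ^ 2 * ((T : ℝ) ^ (-(2 * θ)) *
        ∑ k ∈ Finset.Icc 1 (T - 1), (1 + η₁ * (T : ℝ) ^ (-θ) * k) ^ (-p))
      ≤ η₁ ^ 2 * (η₁ / 2) ^ (-p) * (C * (T : ℝ) ^ (-θ))
      + 4 * η₁ ^ 2 * ((T : ℝ) ^ (-(2 * θ)) * (1 / (η₁ * (T : ℝ) ^ (-θ) * (p - 1)))) := by
        refine add_le_add (mul_le_mul_of_nonneg_left (hC T hT) (by positivity)) ?_
        gcongr
        exact sum_one_add_mul_rpow_neg_le ha hp _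
    _ = (η₁ ^ 2 * (η₁ / 2) ^ (-p) * C + 4 * η₁ / (p - 1)) * (T : ℝ) ^ (-θ) := by
        have : (T : ℝ) ^ (-(2 * θ)) = (T : ℝ) ^ (-θ) * (T : ℝ) ^ (-θ) := by
          rw [← Real.rpow_add hT0]
          congr 1
          ring
        rw [this]
        field_simp
    _ ≤ (η₁ ^ 2 * (η₁ / 2) ^ (-p) * C + 4 * η₁ / (p - 1)) *
          (2 ^ θ * ((T : ℝ) + 1) ^ (-θ)) := by
        gcongr
        exact rpow_neg_le_two_rpow_mul hθ.le hT
    _ = _ := by ring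

end steps

section stepConst

variable {η₁ θ : ℝ}

lemma stepRate_pos {T : ℕ} (hT : 1 ≤ T) : 0 < stepRate θ T := by
  have hT' : (1 : ℝ) ≤ T := by exact_mod_cast hT
  unfold stepRate
  split_ifs
  · exact mul_pos (by positivity) (Real.log_pos (by linarith))
  · positivity

lemma stepRate_le (hθ : 0 < θ) (hθ1 : θ < 1) (T : ℕ) :
    stepRate θ T ≤ max (1 / (Real.exp 1 * θ)) 1 := by
  have hT : (1 : ℝ) ≤ (T : ℝ) + 1 := by
    have : (0 : ℝ) ≤ T := T.cast_nonneg
    linarith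
  unfold stepRate
  split_ifs
  · refine le_max_of_le_left ?_
    set v := Real.log ((T : ℝ) + 1) with hv
    rw [Real.rpow_def_of_pos (by linarith), ← hv, le_div_iff₀ (by positivity)]
    -- `u ≤ exp (u - 1)` for `u = θ log (T + 1)`
    have h1 := Real.add_one_le_exp (v * θ - 1)
    have h2 : Real.exp (v * -θ) * Real.exp 1 * Real.exp (v * θ - 1) = 1 := by
      rw [← Real.exp_add, ← Real.exp_add, ← Real.exp_zero]
      congr 1
      ring
    have h3 : 0 < Real.exp (v * -θ) * Real.exp 1 := by positivity
    calc Real.exp (v * -θ) * v * (Real.exp 1 * θ)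
        = Real.exp (v * -θ) * Real.exp 1 * (v * θ) := by ring
      _ ≤ Real.exp (v * -θ) * Real.exp 1 * Real.exp (v * θ - 1) := by
          refine mul_le_mul_of_nonneg_left ?_ h3.le
          linarith
      _ = 1 := h2
  · refine le_max_of_le_right ?_
    exact Real.rpow_le_one_of_one_le_of_nonpos hT (by linarith)

lemma stepSum_nonneg (hη : 0 ≤ η₁) (T : ℕ) : 0 ≤ stepSum η₁ θ T := by
  refine Finset.sum_nonneg fun t _ => ?_
  have : 0 ≤ ∑ j ∈ Finset.Icc (t + 1) T, polyStep η₁ θ j :=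
    Finset.sum_nonneg fun j _ => polyStep_nonneg hη j
  positivity

/-- The infimum defining `C(η₁, 1, θ)` is attained. -/
lemma stepSum_le_stepConst_mul (hη : 0 < η₁) (hθ : 0 < θ) (hθ1 : θ < 1) {T : ℕ} (hT : 2 ≤ T) :
    stepSum η₁ θ T ≤ stepConst η₁ θ * stepRate θ T := by
  have hpos := stepRate_pos (θ := θ) (show 1 ≤ T by omega)
  rw [← div_le_iff₀ hpos]
  refine le_csInf (exists_stepSum_le hη hθ hθ1) fun C hC => ?_
  rw [div_le_iff₀ hpos]
  exact hC T hT

lemma stepConst_nonneg (hη : 0 < η₁) (hθ : 0 < θ) (hθ1 : θ < 1) : 0 ≤ stepConst η₁ θ := by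
  have h := (stepSum_nonneg hη.le 2).trans (stepSum_le_stepConst_mul hη hθ hθ1 le_rfl)
  exact nonneg_of_mul_nonneg_left h (stepRate_pos (by norm_num))

lemma stepSum_le_stepConst_mul_max (hη : 0 < η₁) (hθ : 0 < θ) (hθ1 : θ < 1) (T : ℕ) :
    stepSum η₁ θ T ≤ stepConst η₁ θ * max (1 / (Real.exp 1 * θ)) 1 := by
  have h0 := stepConst_nonneg hη hθ hθ1
  by_cases hT : 2 ≤ T
  · exact (stepSum_le_stepConst_mul hη hθ hθ1 hT).trans
      (mul_le_mul_of_nonneg_left (stepRate_le hθ hθ1 T) h0)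
  · have : T - 1 = 0 := by omega
    rw [stepSum, this]
    have hmax : (0 : ℝ) ≤ max (1 / (Real.exp 1 * θ)) 1 := le_max_of_le_right zero_le_one
    simpa using mul_nonneg h0 hmax

end stepConst

/-! ### The variance -/

section variance

variable {η₁ θ : ℝ} {ι : Type*} {l : ι → ℝ}

lemma polyStep_mul_le_one (hη : 0 ≤ η₁) (hθ : 0 ≤ θ) (hl : ∀ i, 0 ≤ l i)
    (hηl : ∀ i, η₁ * l i ≤ 1) {j : ℕ} (hj : 1 ≤ j) (i : ι) : polyStep η₁ θ j * l i ≤ 1 :=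
  (mul_le_mul_of_nonneg_right (polyStep_le hη hθ hj) (hl i)).trans (hηl i)

/-- The variance terms `η_t ^ 2 Tr(L ^ 2 Q_t ^ 2)` for `Q_t = ∏_{j=t+1}^n (1 - η_j L)`. It is used for
the given exponent `s`, where `τ = Tr(L ^ s)`, and for `s = 1`. -/
lemma sum_variance_le (hη : 0 ≤ η₁) (hθ : 0 ≤ θ) (hl : ∀ i, 0 ≤ l i) (hl1 : ∀ i, l i ≤ 1)
    (hηl : ∀ i, η₁ * l i ≤ 1) {s p : ℝ} (hs : 0 < s) (hp : 0 < p) (hsp : s + p = 2) {τ : ℝ}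
    (hτ0 : 0 ≤ τ) (hτ : ∑' i, ENNReal.ofReal (l i ^ s) ≤ ENNReal.ofReal τ) (n : ℕ)
    (J : Finset ℕ) :
    ∑ t ∈ J, ENNReal.ofReal (polyStep η₁ θ t ^ 2) *
        ∑' i, ENNReal.ofReal
          (l i ^ 2 * (∏ j ∈ Finset.Icc (t + 1) n, (1 - polyStep η₁ θ j * l i)) ^ 2)
      ≤ ENNReal.ofReal ((1 + p / 2) ^ p * τ * ∑ t ∈ J,
        polyStep η₁ θ t ^ 2 / (1 + ∑ j ∈ Finset.Icc (t + 1) n, polyStep η₁ θ j) ^ p) := by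
  have hσ : ∀ t, 0 ≤ ∑ j ∈ Finset.Icc (t + 1) n, polyStep η₁ θ j := fun t =>
    Finset.sum_nonneg fun j _ => polyStep_nonneg hη j
  have hterm : ∀ t, 0 ≤ (1 + p / 2) ^ p * τ *
      (polyStep η₁ θ t ^ 2 / (1 + ∑ j ∈ Finset.Icc (t + 1) n, polyStep η₁ θ j) ^ p) := fun t => by
    have := hσ t
    positivity
  rw [Finset.mul_sum, ENNReal.ofReal_sum_of_nonneg fun t _ => hterm t]
  refine Finset.sum_le_sum fun t _ => ?_
  have h1 := tsum_rpow_mul_prod_sq_le (J := Finset.Icc (t + 1) n) (η := polyStep η₁ θ) hl hl1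
    (fun j _ => polyStep_nonneg hη j)
    (fun j hj i => polyStep_mul_le_one hη hθ hl hηl (by have := (Finset.mem_Icc.1 hj).1; omega) i)
    hs hp hsp.symm
  simp_rw [Real.rpow_ofNat] at h1
  have hσt := hσ t
  calc _ ≤ ENNReal.ofReal (polyStep η₁ θ t ^ 2) * (ENNReal.ofReal ((1 + p / 2) ^ p /
        (1 + ∑ j ∈ Finset.Icc (t + 1) n, polyStep η₁ θ j) ^ p) * ENNReal.ofReal τ) := by
        gcongr
        exact h1.trans (by gcongr)
    _ = _ := by
        rw [← ENNReal.ofReal_mul (by positivity), ← ENNReal.ofReal_mul (by positivity)]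
        congr 1
        ring

/-- The total weight of the noise, which the smallness of the step size is about. -/
lemma sum_variance_le_stepConst (hη : 0 < η₁) (hθ : 0 < θ) (hθ1 : θ < 1) (hl : ∀ i, 0 ≤ l i)
    (hl1 : ∀ i, l i ≤ 1) (hηl : ∀ i, η₁ * l i ≤ 1)
    (hsum : ∑' i, ENNReal.ofReal (l i) ≤ 1) (n : ℕ) :
    ∑ t ∈ Finset.Icc 1 n, ENNReal.ofReal (polyStep η₁ θ t ^ 2) *
        ∑' i, ENNReal.ofReal
          (l i ^ 2 * (∏ j ∈ Finset.Icc (t + 1) n, (1 - polyStep η₁ θ j * l i)) ^ 2)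
      ≤ ENNReal.ofReal (3 * stepConst η₁ θ * max (1 / (Real.exp 1 * θ)) 1 + η₁ ^ 2) := by
  have hC := stepConst_nonneg hη hθ hθ1
  have hmax : (0 : ℝ) ≤ max (1 / (Real.exp 1 * θ)) 1 := le_max_of_le_right zero_le_one
  rcases n with - | m
  · simp
  rw [Finset.sum_Icc_succ_top (by omega), ENNReal.ofReal_add (by positivity) (by positivity)]
  refine add_le_add ?_ ?_
  · refine (sum_variance_le hη.le hθ.le hl hl1 hηl one_pos one_pos (by norm_num) zero_le_one
      (by simpa using hsum) (m + 1) (Finset.Icc 1 m)).trans (ENNReal.ofReal_le_ofReal ?_)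
    have h := stepSum_le_stepConst_mul_max hη hθ hθ1 (m + 1)
    rw [stepSum, Nat.add_sub_cancel] at h
    simp only [Real.rpow_one, mul_one]
    have := mul_nonneg hC hmax
    linarith
  · have h : ∑' i, ENNReal.ofReal (l i ^ 2 * (∏ j ∈ Finset.Icc (m + 1 + 1) (m + 1),
        (1 - polyStep η₁ θ j * l i)) ^ 2) ≤ 1 := by
      refine le_trans (ENNReal.tsum_le_tsum fun i => ENNReal.ofReal_le_ofReal ?_) hsum
      have h1 := hl i
      have h2 := hl1 i
      rw [Finset.Icc_eq_empty (by omega), Finset.prod_empty]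
      nlinarith
    calc _ ≤ ENNReal.ofReal (polyStep η₁ θ (m + 1) ^ 2) * 1 := by gcongr
      _ ≤ _ := by
        rw [mul_one]
        refine ENNReal.ofReal_le_ofReal ?_
        exact pow_le_pow_left₀ (polyStep_nonneg hη.le _) (polyStep_le hη.le hθ.le (by omega)) 2

end variance

/-! ### The mean error is bounded, and its rate -/

lemma summable_of_tsum_ofReal_ne_top {ι : Type*} {f : ι → ℝ} (hf : ∀ i, 0 ≤ f i)
    (h : ∑' i, ENNReal.ofReal (f i) ≠ ∞) : Summable f := by
  refine (ENNReal.summable_toReal h).congr fun i => ?_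
  rw [ENNReal.toReal_ofReal (hf i)]

lemma le_one_of_tsum_ofReal_le_one {ι : Type*} {f : ι → ℝ} (h : ∑' i, ENNReal.ofReal (f i) ≤ 1) (i : ι) :
    f i ≤ 1 :=
  ENNReal.ofReal_le_one.1 ((ENNReal.le_tsum i).trans h)

lemma eigenvalue_le_norm {H : Type*} [NormedAddCommGroup H] [InnerProductSpace ℝ H] {ι : Type*}
    {b : HilbertBasis ι ℝ H} {l : ι → ℝ} {L : H →L[ℝ] H} (hL : IsDiag b L l) (i : ι) : l i ≤ ‖L‖ := by
  have h := L.le_opNorm (b i)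
  rw [hL.apply_basis, norm_smul, b.orthonormal.1, mul_one, mul_one] at h
  exact (le_abs_self _).trans h

section rates

universe w

variable {H₁ : Type*} [NormedAddCommGroup H₁] [InnerProductSpace ℝ H₁] [CompleteSpace H₁]
  [TopologicalSpace.SeparableSpace H₁]
variable {H₂ : Type*} [NormedAddCommGroup H₂] [InnerProductSpace ℝ H₂]
variable {Ω : Type*} [MeasurableSpace Ω] {μ : Measure Ω} {x : Ω → H₁}
  {ε y : Ω → H₂} {Sd : H₁ →L[ℝ] H₂}
variable {ι : Type*} {b : HilbertBasis ι ℝ H₁} {l : ι → ℝ}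

lemma tsum_eigenvalue_le_one (hx : MemLp x 2 μ) (hx1 : ∫ ω, ‖x ω‖ ^ 2 ∂μ ≤ 1)
    (hL : IsDiag b (covOp μ x) l) : ∑' i, ENNReal.ofReal (l i) ≤ 1 := by
  have h := hL.sqMoment_eq hx IsDiag.one
  simp only [Pi.one_apply, one_pow, one_mul, sqMoment, one_apply_eq_self] at h
  rw [← h, ← ofReal_integral_norm_sq hx]
  exact ENNReal.ofReal_le_one.2 hx1

lemma sqMoment_comp_resid_le (hx : MemLp x 2 μ) (hL : IsDiag b (covOp μ x) l)
    (hl1 : ∑' i, ENNReal.ofReal (l i) ≤ 1) {η₁ θ : ℝ} (hη : 0 < η₁) (hθ : 0 < θ)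
    (hηl : ∀ i, η₁ * l i ≤ 1) (A : H₁ →L[ℝ] H₂) (n : ℕ) :
    sqMoment μ x (A ∘L resid (covOp μ x) (polyStep η₁ θ) n 0) ≤ ENNReal.ofReal (‖A‖ ^ 2) := by
  have hl := eigenvalue_nonneg hx hL
  refine (sqMoment_comp_le _ _).trans ?_
  rw [ENNReal.ofReal_pow (norm_nonneg _), ofReal_norm]
  refine mul_le_of_le_one_right' ?_
  rw [hL.sqMoment_eq hx (hL.resid _ n 0)]
  refine le_trans (ENNReal.tsum_le_tsum fun i => ENNReal.ofReal_le_ofReal ?_) hl1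
  have h1 : ∀ j ∈ Finset.Icc (0 + 1) n, polyStep η₁ θ j * l i ≤ 1 := fun j hj =>
    polyStep_mul_le_one hη.le hθ.le hl hηl (by simpa using (Finset.mem_Icc.1 hj).1) i
  refine mul_le_of_le_one_left (hl i) ((prod_one_sub_sq_le h1).trans ?_)
  have h2 : 0 ≤ ∑ j ∈ Finset.Icc (0 + 1) n, polyStep η₁ θ j :=
    Finset.sum_nonneg fun j _ => polyStep_nonneg hη.le j
  have := hl i
  exact Real.exp_le_one_iff.2 (by simpa using by positivity)

/-- The bias, by the source condition `S† = J L ^ r` and the trace condition on `L ^ s`. -/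
lemma exists_bias_le (hx : MemLp x 2 μ)
    (hL : IsDiag b (covOp μ x) l) (hl1 : ∑' i, ENNReal.ofReal (l i) ≤ 1)
    {η₁ θ : ℝ} (hη : 0 < η₁) (hθ : 0 < θ) (hηl : ∀ i, η₁ * l i ≤ 1)
    {r s : ℝ} (hr : 0 < r) (hs : 0 < s) (hs1 : s ≤ 1) {τ : ℝ} (hτ0 : 0 ≤ τ)
    (hτ : ∑' i, ENNReal.ofReal (l i ^ s) ≤ ENNReal.ofReal τ)
    (hθr : θ ≤ (1 - θ) * (2 * r + 1 - s)) (J : H₁ →L[ℝ] H₂) :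
    ∃ K : ℝ, 0 ≤ K ∧ ∀ T : ℕ, 1 ≤ T →
      sqMoment μ x ((J ∘L opPow (covOp μ x) r) ∘L resid (covOp μ x) (polyStep η₁ θ) T 0)
        ≤ ENNReal.ofReal (K * ((T : ℝ) + 1) ^ (-θ)) := by
  have hl := eigenvalue_nonneg hx hL
  have hsum := summable_of_tsum_ofReal_ne_top hl (ne_top_of_le_ne_top ENNReal.one_ne_top hl1)
  set p : ℝ := 2 * r + 1 - s with hp
  have hp0 : 0 < p := by rw [hp]; linarith
  refine ⟨‖J‖ ^ 2 * ((1 + p / 2) ^ p * η₁ ^ (-p) * 2 ^ θ * τ), by positivity, fun T hT => ?_⟩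
  have hT1 : (1 : ℝ) ≤ T := by exact_mod_cast hT
  have hT0 : (0 : ℝ) < T := by linarith
  set σ : ℝ := ∑ j ∈ Finset.Icc (0 + 1) T, polyStep η₁ θ j with hσ
  have h1 : sqMoment μ x (opPow (covOp μ x) r ∘L resid (covOp μ x) (polyStep η₁ θ) T 0)
      ≤ ENNReal.ofReal ((1 + p / 2) ^ p / (1 + σ) ^ p) * ENNReal.ofReal τ := by
    rw [hL.sqMoment_eq hx ((hL.opPow hl hsum hr).comp (hL.resid _ T 0))]
    refine le_trans (le_of_eq (tsum_congr fun i => ?_))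
      ((tsum_rpow_mul_prod_sq_le (J := Finset.Icc (0 + 1) T) (η := polyStep η₁ θ)
        (q := 2 * r + 1) hl (le_one_of_tsum_ofReal_le_one hl1)
        (fun j _ => polyStep_nonneg hη.le j)
        (fun j hj i => polyStep_mul_le_one hη.le hθ.le hl hηl
          (by simpa using (Finset.mem_Icc.1 hj).1) i) hs hp0 (by rw [hp]; ring)).trans
        (by gcongr))
    congr 1
    rw [Real.rpow_add_of_nonneg (hl i) (by positivity) zero_le_one, Real.rpow_one, mul_pow,
      mul_comm 2 r, Real.rpow_mul (hl i), Real.rpow_ofNat]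
    ring
  have h2 : (1 + σ) ^ (-p) ≤ η₁ ^ (-p) * (2 ^ θ * ((T : ℝ) + 1) ^ (-θ)) := by
    have h3 : η₁ * (T : ℝ) ^ (1 - θ) ≤ 1 + σ := by
      have h4 := mul_rpow_le_sum_polyStep hη.le hθ.le (Nat.zero_le T)
      rw [sub_eq_add_neg, Real.rpow_add hT0, Real.rpow_one]
      rw [Nat.cast_zero, sub_zero] at h4
      linarith
    calc (1 + σ) ^ (-p) ≤ (η₁ * (T : ℝ) ^ (1 - θ)) ^ (-p) :=
          Real.rpow_le_rpow_of_nonpos (by positivity) h3 (by linarith)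
      _ = η₁ ^ (-p) * (T : ℝ) ^ (-((1 - θ) * p)) := by
          rw [Real.mul_rpow hη.le (by positivity), ← Real.rpow_mul hT0.le, mul_neg]
      _ ≤ η₁ ^ (-p) * (T : ℝ) ^ (-θ) := by gcongr
      _ ≤ _ := by
          gcongr
          exact rpow_neg_le_two_rpow_mul hθ.le hT
  have hσ0 : 0 ≤ σ := Finset.sum_nonneg fun j _ => polyStep_nonneg hη.le j
  rw [ContinuousLinearMap.comp_assoc]
  refine (sqMoment_comp_le _ _).trans ((mul_le_mul_right h1 _).trans ?_)
  rw [← ofReal_norm, ← ENNReal.ofReal_pow (norm_nonneg _), ← ENNReal.ofReal_mul (by positivity),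
    ← ENNReal.ofReal_mul (by positivity)]
  refine ENNReal.ofReal_le_ofReal ?_
  calc ‖J‖ ^ 2 * ((1 + p / 2) ^ p / (1 + σ) ^ p * τ)
      = ‖J‖ ^ 2 * ((1 + p / 2) ^ p * (1 + σ) ^ (-p) * τ) := by
        rw [Real.rpow_neg (by positivity)]
        ring
    _ ≤ ‖J‖ ^ 2 * ((1 + p / 2) ^ p * (η₁ ^ (-p) * (2 ^ θ * ((T : ℝ) + 1) ^ (-θ))) * τ) := by
        gcongr
    _ = _ := by ring

variable [MeasurableSpace H₁] [BorelSpace H₁] [CompleteSpace H₂]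
  [TopologicalSpace.SeparableSpace H₂] [MeasurableSpace H₂] [BorelSpace H₂]
  [IsProbabilityMeasure μ]

/-- Under the smallness condition on the step size the noise feeding on the mean error cannot make
it grow: the bound `M` below is the fixed point of the resulting inequality. -/
lemma exists_meanErr_le_bias_add (hx : MemLp x 2 μ) (hε : MemLp ε 2 μ) (hε0 : ∫ ω, ε ω ∂μ = 0)
    (hind : IndepFun x ε μ) (hy : ∀ ω, y ω = Sd (x ω) + ε ω) (hSd : IsCompactOperator Sd)
    {c : ℝ} (hc : 0 < c) (hm1 : MomentCondition μ x H₁ c) (hm2 : MomentCondition μ x H₂ c)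
    (hL : IsDiag b (covOp μ x) l) (hl1 : ∑' i, ENNReal.ofReal (l i) ≤ 1)
    {η₁ θ : ℝ} (hη : 0 < η₁) (hθ : 0 < θ) (hθ1 : θ < 1) (hηl : ∀ i, η₁ * l i ≤ 1)
    (hcond : StepCondition c η₁ θ) :
    ∃ W : ℝ, 0 ≤ W ∧ ∀ (Ω' : Type w) [MeasurableSpace Ω'] (P : Measure Ω') [IsProbabilityMeasure P]
      (z : ℕ → Ω' → H₁ × H₂) (T : ℕ), IsIIDSample μ (fun ω => (x ω, y ω)) P T z → ∀ n ≤ T,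
      meanErr μ x P z (polyStep η₁ θ) Sd n 1
        ≤ sqMoment μ x (Sd ∘L resid (covOp μ x) (polyStep η₁ θ) n 0)
          + ENNReal.ofReal W * ∑ t ∈ Finset.Icc 1 n, ENNReal.ofReal (polyStep η₁ θ t ^ 2) *
            ∑' i, ENNReal.ofReal
              (l i ^ 2 * (∏ j ∈ Finset.Icc (t + 1) n, (1 - polyStep η₁ θ j * l i)) ^ 2) := by
  have hl := eigenvalue_nonneg hx hL
  have hsum := summable_of_tsum_ofReal_ne_top hl (ne_top_of_le_ne_top ENNReal.one_ne_top hl1)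
  set κ : ℝ := 3 * stepConst η₁ θ * max (1 / (Real.exp 1 * θ)) 1 + η₁ ^ 2 with hκ
  have hκ0 : 0 ≤ κ := by
    have := stepConst_nonneg hη hθ hθ1
    have : (0 : ℝ) ≤ max (1 / (Real.exp 1 * θ)) 1 := le_max_of_le_right zero_le_one
    positivity
  have hcκ : c * κ < 1 := hcond
  -- the Young parameter leaves room in the smallness condition
  set δ : ℝ := (1 - c * κ) / 2 with hδ
  have hδ0 : 0 < δ := by rw [hδ]; linarith
  have hgap : 0 < 1 - (1 + δ) * c * κ := by
    have : c * κ = 1 - 2 * δ := by rw [hδ]; ring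
    have h2 : (1 + δ) * c * κ = (1 + δ) * (1 - 2 * δ) := by rw [mul_assoc, this]
    rw [h2]
    nlinarith
  set v : ℝ := (1 + δ⁻¹) * ∫ ω, ‖ε ω‖ ^ 2 ∂μ with hv
  have hv0 : 0 ≤ v := mul_nonneg (by positivity) (integral_nonneg fun ω => by positivity)
  set M : ℝ := (‖Sd‖ ^ 2 + v * κ) / (1 - (1 + δ) * c * κ) with hM
  have hM0 : 0 ≤ M := by positivity
  have hMeq : ‖Sd‖ ^ 2 + ((1 + δ) * c * M + v) * κ = M := by
    have : M * (1 - (1 + δ) * c * κ) = ‖Sd‖ ^ 2 + v * κ := by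
      rw [hM, div_mul_cancel₀ _ hgap.ne']
    linarith
  have hW0 : 0 ≤ (1 + δ) * c * M + v := by positivity
  refine ⟨(1 + δ) * c * M + v, hW0, ?_⟩
  intro Ω' _ P _ z T hz
  have hw : ∀ t, meanErr μ x P z (polyStep η₁ θ) Sd t 1 ≤ ENNReal.ofReal M →
      ENNReal.ofReal (1 + δ) * ENNReal.ofReal c * meanErr μ x P z (polyStep η₁ θ) Sd t 1
        + ENNReal.ofReal (1 + δ⁻¹) * ∫⁻ ω, ‖ε ω‖ₑ ^ 2 ∂μ
        ≤ ENNReal.ofReal ((1 + δ) * c * M + v) := by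
    intro t ht
    rw [ENNReal.ofReal_add (by positivity) hv0, ENNReal.ofReal_mul (by positivity),
      ENNReal.ofReal_mul (by positivity), hv, ENNReal.ofReal_mul (by positivity),
      ofReal_integral_norm_sq hε]
    gcongr
  have hbound : ∀ n ≤ T, meanErr μ x P z (polyStep η₁ θ) Sd n 1 ≤ ENNReal.ofReal M := by
    intro n
    induction n using Nat.strong_induction_on with
    | _ n ih =>
      intro hn
      refine (meanErr_le_bias_add_variance hx hε hε0 hind hy hSd hm1 hm2 hL hsum hz
        (polyStep η₁ θ) hn hδ0 fun t ht => hw t (ih t ht (by omega))).trans ?_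
      calc _ ≤ ENNReal.ofReal (‖Sd‖ ^ 2)
            + ENNReal.ofReal ((1 + δ) * c * M + v) * ENNReal.ofReal κ := by
            refine add_le_add (sqMoment_comp_resid_le hx hL hl1 hη hθ hηl Sd n) ?_
            gcongr
            exact sum_variance_le_stepConst hη hθ hθ1 hl (le_one_of_tsum_ofReal_le_one hl1) hηl
              hl1 n
        _ = ENNReal.ofReal M := by
            rw [← ENNReal.ofReal_mul hW0, ← ENNReal.ofReal_add (by positivity) (by positivity),
              hMeq]
  intro n hn
  exact meanErr_le_bias_add_variance hx hε hε0 hind hy hSd hm1 hm2 hL hsum hz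
    (polyStep η₁ θ) hn hδ0 fun t ht => hw t (hbound t (by omega))

/-- The mean error, up to the sum of step sizes that governs the variance. -/
lemma exists_meanErr_le (hx : MemLp x 2 μ) (hx1 : ∫ ω, ‖x ω‖ ^ 2 ∂μ ≤ 1)
    (hε : MemLp ε 2 μ) (hε0 : ∫ ω, ε ω ∂μ = 0)
    (hind : IndepFun x ε μ) (hy : ∀ ω, y ω = Sd (x ω) + ε ω)
    {r : ℝ} (hr : 0 < r) (hreg : ∃ J : H₁ →L[ℝ] H₂, Sd = J ∘L opPow (covOp μ x) r)
    {s : ℝ} (hs : 0 < s) (hs1 : s ≤ 1) (htr : opTrace (opPow (covOp μ x) s) < ∞)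
    {c : ℝ} (hc : 0 < c) (hm1 : MomentCondition μ x H₁ c) (hm2 : MomentCondition μ x H₂ c)
    {η₁ θ : ℝ} (hη : 0 < η₁) (hθ : 0 < θ) (hθ1 : θ < 1) (hηL : η₁ * ‖covOp μ x‖ < 1)
    (hcond : StepCondition c η₁ θ) (hθr : θ ≤ (1 - θ) * (2 * r + 1 - s)) :
    ∃ K : ℝ, 0 ≤ K ∧ ∀ T : ℕ, 1 ≤ T →
      ∀ (Ω' : Type w) [MeasurableSpace Ω'] (P : Measure Ω') [IsProbabilityMeasure P]
        (z : ℕ → Ω' → H₁ × H₂), IsIIDSample μ (fun ω => (x ω, y ω)) P T z →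
      meanErr μ x P z (polyStep η₁ θ) Sd T 1
        ≤ ENNReal.ofReal (K * (((T : ℝ) + 1) ^ (-θ) + ∑ t ∈ Finset.Icc 1 (T - 1),
          polyStep η₁ θ t ^ 2 /
            (1 + ∑ j ∈ Finset.Icc (t + 1) T, polyStep η₁ θ j) ^ (2 - s))) := by
  obtain ⟨ι, b, l, hL⟩ := exists_hilbertBasis_isDiag (isCompactOperator_covOp hx)
    (isSelfAdjoint_covOp hx)
  have hl := eigenvalue_nonneg hx hL
  have hl1 := tsum_eigenvalue_le_one hx hx1 hL
  have hsum := summable_of_tsum_ofReal_ne_top hl (ne_top_of_le_ne_top ENNReal.one_ne_top hl1)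
  have hηl : ∀ i, η₁ * l i ≤ 1 := fun i =>
    (mul_le_mul_of_nonneg_left (eigenvalue_le_norm hL i) hη.le).trans hηL.le
  obtain ⟨J, hJ⟩ := hreg
  have hSd : IsCompactOperator Sd := by
    rw [hJ]
    exact (hL.isCompactOperator_opPow (isCompactOperator_covOp hx) hl hsum hr).clm_comp J
  rw [(hL.opPow hl hsum hs).opTrace_eq fun i => Real.rpow_nonneg (hl i) s] at htr
  set τ : ℝ := (∑' i, ENNReal.ofReal (l i ^ s)).toReal with hτdef
  have hτ0 : 0 ≤ τ := ENNReal.toReal_nonneg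
  have hτ : ∑' i, ENNReal.ofReal (l i ^ s) ≤ ENNReal.ofReal τ :=
    (ENNReal.ofReal_toReal htr.ne).ge
  obtain ⟨W, hW0, hW⟩ := exists_meanErr_le_bias_add.{w} hx hε hε0 hind hy hSd hc hm1 hm2 hL hl1 hη
    hθ hθ1 hηl hcond
  obtain ⟨B, hB0, hB⟩ := exists_bias_le hx hL hl1 hη hθ hηl hr hs hs1 hτ0 hτ hθr J
  set p : ℝ := 2 - s with hp
  have hp0 : 0 < p := by rw [hp]; linarith
  set V : ℝ := W * ((1 + p / 2) ^ p * τ) with hV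
  have hV0 : 0 ≤ V := by positivity
  refine ⟨B + V * (η₁ ^ 2 * 2 ^ θ + 1), by positivity, ?_⟩
  intro T hT Ω' _ P _ z hz
  have hT1 : (1 : ℝ) ≤ T := by exact_mod_cast hT
  set G : ℝ := ∑ t ∈ Finset.Icc 1 (T - 1),
    polyStep η₁ θ t ^ 2 / (1 + ∑ j ∈ Finset.Icc (t + 1) T, polyStep η₁ θ j) ^ p with hG
  have hG0 : 0 ≤ G := Finset.sum_nonneg fun t _ => by
    have : 0 ≤ ∑ j ∈ Finset.Icc (t + 1) T, polyStep η₁ θ j :=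
      Finset.sum_nonneg fun j _ => polyStep_nonneg hη.le j
    positivity
  -- the last step has weight `η_T ^ 2`
  have hsplit : ∑ t ∈ Finset.Icc 1 T,
      polyStep η₁ θ t ^ 2 / (1 + ∑ j ∈ Finset.Icc (t + 1) T, polyStep η₁ θ j) ^ p
      = G + polyStep η₁ θ T ^ 2 := by
    obtain ⟨m, rfl⟩ : ∃ m, T = m + 1 := ⟨T - 1, by omega⟩
    rw [Finset.sum_Icc_succ_top (by omega), hG, Nat.add_sub_cancel]
    simp
  have hlast : polyStep η₁ θ T ^ 2 ≤ η₁ ^ 2 * 2 ^ θ * ((T : ℝ) + 1) ^ (-θ) := by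
    calc polyStep η₁ θ T ^ 2 = η₁ ^ 2 * ((T : ℝ) ^ (-θ) * (T : ℝ) ^ (-θ)) := by
          rw [polyStep]; ring
      _ ≤ η₁ ^ 2 * (1 * (2 ^ θ * ((T : ℝ) + 1) ^ (-θ))) := by
          gcongr
          · exact Real.rpow_le_one_of_one_le_of_nonpos hT1 (by linarith)
          · exact rpow_neg_le_two_rpow_mul hθ.le hT
      _ = _ := by ring
  have hX : 0 ≤ ((T : ℝ) + 1) ^ (-θ) := by positivity
  calc meanErr μ x P z (polyStep η₁ θ) Sd T 1
      ≤ ENNReal.ofReal (B * ((T : ℝ) + 1) ^ (-θ))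
        + ENNReal.ofReal W * ENNReal.ofReal ((1 + p / 2) ^ p * τ * (G + polyStep η₁ θ T ^ 2)) := by
        refine (hW Ω' P z T hz T le_rfl).trans (add_le_add ?_ ?_)
        · simp_rw [← hJ] at hB
          exact hB T hT
        · gcongr
          rw [← hsplit]
          exact sum_variance_le hη.le hθ.le hl (le_one_of_tsum_ofReal_le_one hl1) hηl hs hp0
            (by rw [hp]; ring) hτ0 hτ T (Finset.Icc 1 T)
    _ = ENNReal.ofReal (B * ((T : ℝ) + 1) ^ (-θ) + V * (G + polyStep η₁ θ T ^ 2)) := by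
        rw [← ENNReal.ofReal_mul hW0, ← ENNReal.ofReal_add (by positivity) (by positivity), hV]
        congr 2
        ring
    _ ≤ _ := by
        refine ENNReal.ofReal_le_ofReal ?_
        have h1 := mul_le_mul_of_nonneg_left hlast hV0
        have h2 : 0 ≤ (B + V * (η₁ ^ 2 * 2 ^ θ)) * G := by positivity
        have h3 : 0 ≤ V * ((T : ℝ) + 1) ^ (-θ) := by positivity
        nlinarith

end rates

/-! ### The excess risk -/

section risk

variable {H₁ : Type*} [NormedAddCommGroup H₁] [InnerProductSpace ℝ H₁] [CompleteSpace H₁]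
  [MeasurableSpace H₁] [BorelSpace H₁]
variable {H₂ : Type*} [NormedAddCommGroup H₂] [InnerProductSpace ℝ H₂] [CompleteSpace H₂]
  [MeasurableSpace H₂] [BorelSpace H₂]
variable {Ω : Type*} [MeasurableSpace Ω] {μ : Measure Ω} [IsProbabilityMeasure μ] {x : Ω → H₁}
  {ε y : Ω → H₂} {Sd : H₁ →L[ℝ] H₂}

lemma risk_sub_risk (hx : MemLp x 2 μ) (hε : MemLp ε 2 μ) (hε0 : ∫ ω, ε ω ∂μ = 0)
    (hind : IndepFun x ε μ) (hy : ∀ ω, y ω = Sd (x ω) + ε ω) (S : H₁ →L[ℝ] H₂) :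
    risk μ x y S - risk μ x y Sd = (sqMoment μ x (S - Sd)).toReal := by
  set A := S - Sd with hA
  have hAx : MemLp (fun ω => A (x ω)) 2 μ := A.comp_memLp' hx
  have hcross : ∫ ω, inner ℝ (A (x ω)) (ε ω) ∂μ = 0 := by
    have h := hind.integral_bilin (hx.integrable one_le_two) (hε.integrable one_le_two)
      ((innerSL ℝ : H₂ →L[ℝ] H₂ →L[ℝ] ℝ) ∘L A)
    rw [hε0, map_zero] at h
    exact h
  have hcri : Integrable (fun ω => inner ℝ (A (x ω)) (ε ω)) μ :=
    Integrable.mono' (g := fun ω => ‖A (x ω)‖ * ‖ε ω‖) (hAx.norm.integrable_mul hε.norm)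
      (hAx.1.inner hε.1) (Filter.Eventually.of_forall fun ω => norm_inner_le_norm _ _)
  have h1 : ∀ ω, ‖y ω - S (x ω)‖ ^ 2
      = ‖A (x ω)‖ ^ 2 - 2 * inner ℝ (A (x ω)) (ε ω) + ‖ε ω‖ ^ 2 := by
    intro ω
    rw [← norm_sub_sq_real, ← norm_neg, hy, hA, sub_apply]
    congr 2
    abel
  have h2 : ∀ ω, ‖y ω - Sd (x ω)‖ ^ 2 = ‖ε ω‖ ^ 2 := fun ω => by rw [hy, add_sub_cancel_left]
  have hA2 : Integrable (fun ω => ‖A (x ω)‖ ^ 2) μ := hAx.integrable_norm_pow two_ne_zero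
  have hε2 : Integrable (fun ω => ‖ε ω‖ ^ 2) μ := hε.integrable_norm_pow two_ne_zero
  have hi : Integrable (fun ω => ‖A (x ω)‖ ^ 2 - 2 * inner ℝ (A (x ω)) (ε ω)) μ :=
    hA2.sub (hcri.const_mul 2)
  unfold risk
  simp_rw [h1, h2]
  rw [integral_add hi hε2, integral_sub hA2 (hcri.const_mul 2), integral_const_mul, hcross,
    sqMoment, ← ofReal_integral_norm_sq hAx,
    ENNReal.toReal_ofReal (integral_nonneg fun ω => by positivity)]
  ring

variable [TopologicalSpace.SeparableSpace H₁] [TopologicalSpace.SeparableSpace H₂]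

lemma integrable_and_integral_excess_risk_le (hx : MemLp x 2 μ) (hε : MemLp ε 2 μ)
    (hε0 : ∫ ω, ε ω ∂μ = 0) (hind : IndepFun x ε μ) (hy : ∀ ω, y ω = Sd (x ω) + ε ω)
    {Ω' : Type*} [MeasurableSpace Ω'] {P : Measure Ω'} {z : ℕ → Ω' → H₁ × H₂} {T : ℕ}
    (hz : IsIIDSample μ (fun ω => (x ω, y ω)) P T z) (η : ℕ → ℝ) {B : ℝ} (hB : 0 ≤ B)
    (h : meanErr μ x P z η Sd T 1 ≤ ENNReal.ofReal B) :
    Integrable (fun ω' => risk μ x y (sgd η (fun t => z t ω') T) - risk μ x y Sd) P ∧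
      ∫ ω', (risk μ x y (sgd η (fun t => z t ω') T) - risk μ x y Sd) ∂P ≤ B := by
  simp_rw [risk_sub_risk hx hε hε0 hind hy]
  have hm : AEMeasurable (fun ω' => sqMoment μ x (sgd η (fun t => z t ω') T - Sd)) P :=
    hz.aemeasurable_sgd η le_rfl
      ((continuous_sqMoment hx).comp (continuous_id.sub continuous_const))
  have h' : ∫⁻ ω', sqMoment μ x (sgd η (fun t => z t ω') T - Sd) ∂P ≤ ENNReal.ofReal B := h
  refine ⟨integrable_toReal_of_lintegral_ne_top hm
    (ne_top_of_le_ne_top ENNReal.ofReal_ne_top h'), ?_⟩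
  rw [integral_toReal hm (Filter.Eventually.of_forall fun ω' =>
    (sqMoment_ne_top hx _).lt_top)]
  exact ENNReal.toReal_le_of_le_ofReal hB h'

end risk

end OperatorSGD

theorem mainTheorem1
    {H₁ : Type*} [NormedAddCommGroup H₁] [InnerProductSpace ℝ H₁] [CompleteSpace H₁]
    [TopologicalSpace.SeparableSpace H₁] [MeasurableSpace H₁] [BorelSpace H₁]
    {H₂ : Type*} [NormedAddCommGroup H₂] [InnerProductSpace ℝ H₂] [CompleteSpace H₂]
    [TopologicalSpace.SeparableSpace H₂] [MeasurableSpace H₂] [BorelSpace H₂]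
    {Ω : Type*} [MeasurableSpace Ω] (μ : Measure Ω) [IsProbabilityMeasure μ]
    -- the model `y = Sd x + ε`
    (x : Ω → H₁) (ε y : Ω → H₂) (Sd : H₁ →L[ℝ] H₂)
    (hx : MemLp x 2 μ) (hx1 : ∫ ω, ‖x ω‖ ^ 2 ∂μ ≤ 1)
    (hε : MemLp ε 2 μ) (hε0 : ∫ ω, ε ω ∂μ = 0) (hind : IndepFun x ε μ)
    (hy : ∀ ω, y ω = Sd (x ω) + ε ω)
    -- weak regularity, spectral decay, moment condition
    (r : ℝ) (hr : 0 < r)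
    (hreg : ∃ J : H₁ →L[ℝ] H₂, Sd = J ∘L OperatorSGD.opPow (OperatorSGD.covOp μ x) r)
    (s : ℝ) (hs : 0 < s) (hs1 : s ≤ 1)
    (htr : OperatorSGD.opTrace (OperatorSGD.opPow (OperatorSGD.covOp μ x) s) < ∞)
    (c : ℝ) (hc : 0 < c)
    (hm1 : OperatorSGD.MomentCondition μ x H₁ c) (hm2 : OperatorSGD.MomentCondition μ x H₂ c)
    -- the step size
    (η₁ : ℝ) (hη : 0 < η₁) (hηL : η₁ * ‖OperatorSGD.covOp μ x‖ < 1)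
    (θ : ℝ) (hcond : OperatorSGD.StepCondition c η₁ θ) :
    (s = 1 → θ = min (2 * r / (2 * r + 1)) (1 / 2) →
      ∃ C : ℝ, ∀ T : ℕ, 1 ≤ T →
        ∀ (Ω' : Type*) [MeasurableSpace Ω'] (P : Measure Ω') [IsProbabilityMeasure P]
          (z : ℕ → Ω' → H₁ × H₂),
          OperatorSGD.IsIIDSample μ (fun ω => (x ω, y ω)) P T z →
          Integrable (fun ω' => OperatorSGD.risk μ x y
              (OperatorSGD.sgd (OperatorSGD.polyStep η₁ θ) (fun t => z t ω') T)
              - OperatorSGD.risk μ x y Sd) P ∧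
          ∫ ω', (OperatorSGD.risk μ x y
              (OperatorSGD.sgd (OperatorSGD.polyStep η₁ θ) (fun t => z t ω') T)
              - OperatorSGD.risk μ x y Sd) ∂P
            ≤ C * ((T : ℝ) + 1) ^ (-θ) * Real.log ((T : ℝ) + 1)) ∧
    (s < 1 → θ = min ((2 * r + 1 - s) / (2 * r + 2 - s)) ((2 - s) / (3 - s)) →
      (r < 1 / 2 → θ = (2 * r + 1 - s) / (2 * r + 2 - s)) ∧
      (1 / 2 ≤ r → θ = (2 - s) / (3 - s)) ∧
      ∃ C : ℝ, ∀ T : ℕ, 1 ≤ T →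
        ∀ (Ω' : Type*) [MeasurableSpace Ω'] (P : Measure Ω') [IsProbabilityMeasure P]
          (z : ℕ → Ω' → H₁ × H₂),
          OperatorSGD.IsIIDSample μ (fun ω => (x ω, y ω)) P T z →
          Integrable (fun ω' => OperatorSGD.risk μ x y
              (OperatorSGD.sgd (OperatorSGD.polyStep η₁ θ) (fun t => z t ω') T)
              - OperatorSGD.risk μ x y Sd) P ∧
          ∫ ω', (OperatorSGD.risk μ x y
              (OperatorSGD.sgd (OperatorSGD.polyStep η₁ θ) (fun t => z t ω') T)
              - OperatorSGD.risk μ x y Sd) ∂P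
            ≤ C * ((T : ℝ) + 1) ^ (-θ)) := by
  constructor
  · intro hs1' hθ
    subst hs1'
    have hθ0 : 0 < θ := by
      rw [hθ]
      exact lt_min (by positivity) (by norm_num)
    have hθ2 : θ ≤ 1 / 2 := hθ ▸ min_le_right _ _
    have hθr : θ ≤ (1 - θ) * (2 * r + 1 - 1) := by
      have h : θ ≤ 2 * r / (2 * r + 1) := hθ ▸ min_le_left _ _
      rw [le_div_iff₀ (by positivity)] at h
      linarith
    have hθ1 : θ < 1 := by linarith
    obtain ⟨K, hK0, hK⟩ := OperatorSGD.exists_meanErr_le hx hx1 hε hε0 hind hy hr hreg hs hs1 htr hc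
      hm1 hm2 hη hθ0 hθ1 hηL hcond hθr
    have hC := OperatorSGD.stepConst_nonneg hη hθ0 hθ1
    have hlog2 : 0 < Real.log 2 := Real.log_pos (by norm_num)
    refine ⟨K * ((Real.log 2)⁻¹ + OperatorSGD.stepConst η₁ θ), fun T hT Ω' _ P _ z hz => ?_⟩
    have hT1 : (1 : ℝ) ≤ T := by exact_mod_cast hT
    have hlog : Real.log 2 ≤ Real.log ((T : ℝ) + 1) := Real.log_le_log (by norm_num) (by linarith)
    have hlog0 : 0 ≤ Real.log ((T : ℝ) + 1) := hlog2.le.trans hlog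
    have hX : 0 ≤ ((T : ℝ) + 1) ^ (-θ) := by positivity
    refine OperatorSGD.integrable_and_integral_excess_risk_le hx hε hε0 hind hy hz _ (by positivity)
      ((hK T hT Ω' P z hz).trans (ENNReal.ofReal_le_ofReal ?_))
    have h1 : ((T : ℝ) + 1) ^ (-θ)
        ≤ (Real.log 2)⁻¹ * (((T : ℝ) + 1) ^ (-θ) * Real.log ((T : ℝ) + 1)) := by
      rw [inv_mul_eq_div, le_div_iff₀ hlog2]
      gcongr
    -- for `T = 1` the sum is empty, while `stepConst` speaks of `T ≥ 2` only
    have h2 : OperatorSGD.stepSum η₁ θ T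
        ≤ OperatorSGD.stepConst η₁ θ * (((T : ℝ) + 1) ^ (-θ) * Real.log ((T : ℝ) + 1)) := by
      by_cases hT2 : 2 ≤ T
      · have := OperatorSGD.stepSum_le_stepConst_mul hη hθ0 hθ1 hT2
        rwa [OperatorSGD.stepRate, if_pos hθ2] at this
      · have : T - 1 = 0 := by omega
        rw [OperatorSGD.stepSum, this]
        simpa using by positivity
    rw [OperatorSGD.stepSum] at h2
    norm_num
    calc _ ≤ K * ((Real.log 2)⁻¹ * (((T : ℝ) + 1) ^ (-θ) * Real.log ((T : ℝ) + 1))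
          + OperatorSGD.stepConst η₁ θ * (((T : ℝ) + 1) ^ (-θ) * Real.log ((T : ℝ) + 1))) := by
          gcongr
      _ = _ := by ring
  · intro hs1' hθ
    have hd1 : 0 < 2 * r + 2 - s := by linarith
    have hd2 : 0 < 3 - s := by linarith
    refine ⟨fun h => ?_, fun h => ?_, ?_⟩
    · rw [hθ, min_eq_left]
      rw [div_le_div_iff₀ hd1 hd2]
      nlinarith
    · rw [hθ, min_eq_right]
      rw [div_le_div_iff₀ hd2 hd1]
      nlinarith
    have hθ0 : 0 < θ := by
      rw [hθ]
      exact lt_min (div_pos (by linarith) hd1) (div_pos (by linarith) hd2)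
    have hθr : θ ≤ (1 - θ) * (2 * r + 1 - s) := by
      have h : θ ≤ (2 * r + 1 - s) / (2 * r + 2 - s) := hθ ▸ min_le_left _ _
      rw [le_div_iff₀ hd1] at h
      linarith
    have hθs : θ ≤ (1 - θ) * (2 - s) := by
      have h : θ ≤ (2 - s) / (3 - s) := hθ ▸ min_le_right _ _
      rw [le_div_iff₀ hd2] at h
      linarith
    have hθ1 : θ < 1 := by
      by_contra! hcon
      nlinarith
    obtain ⟨K, hK0, hK⟩ := OperatorSGD.exists_meanErr_le hx hx1 hε hε0 hind hy hr hreg hs hs1 htr hc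
      hm1 hm2 hη hθ0 hθ1 hηL hcond hθr
    obtain ⟨C, hC⟩ := OperatorSGD.exists_sum_polyStep_sq_div_rpow_le hη hθ0 hθ1
      (show 1 < 2 - s by linarith) hθs
    refine ⟨K * (1 + |C|), fun T hT Ω' _ P _ z hz => ?_⟩
    refine OperatorSGD.integrable_and_integral_excess_risk_le hx hε hε0 hind hy hz _ (by positivity)
      ((hK T hT Ω' P z hz).trans (ENNReal.ofReal_le_ofReal ?_))
    rw [mul_assoc, add_mul, one_mul]
    gcongr
    refine (hC T hT).trans ?_
    gcongr
    exact le_abs_self C
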